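/- Let $\mu=\mathcal N(m,\Sigma)$ be a Gaussian measure on $\mathbb R^d$ with mean $m\in\mathbb R^d$ and symmetric positive definite covariance matrix $\Sigma$. Let $V=\mathbb R^n$ carry the norm $\|v\|_V=\sqrt{v^T R_V v}$ with $R_V\in\mathbb R^{n\times n}$ symmetric positive definite, and let $\mathcal H=L^2(\mathbb R^d,\mathcal B(\mathbb R^d),\mu;V)$ with norm $\|u\|_{\mathcal H}^2=\int\|u(x)\|_V^2\,d\mu(x)$. Let $f\in\mathcal H$ be continuously differentiable with $\|f(x)-f(y)\|_V\le L\|x-y\|_2$ for all $x,y\in\mathbb R^d$, where $L\ge 0$. Let $$H=\int_{\mathbb R^d}(\nabla f(x))^T R_V\,\nabla f(x)\,d\mu(x)\in\mathbb R^{d\times d},$$ where $\nabla f(x)\in\mathbb R^{n\times d}$ is the Jacobian matrix of $f$. Let $P_r$ be a minimizer of $$P\mapsto \operatorname{trace}\big(\Sigma(I_d-P^T)H(I_d-P)\big)$$ over all rank-$r$ projectors, that is, all $P\in\mathbb R^{d\times d}$ with $P^2=P$ and $\operatorname{rank}P=r$. Let $\lambda_1\ge\dots\ge\lambda_d$ be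 the generalized eigenvalues of the pair $(H,\Sigma^{-1})$, so that $Hv_i=\lambda_i\Sigma^{-1}v_i$ for a $\Sigma^{-1}$-orthonormal basis $v_1,\dots,v_d$ of $\mathbb R^d$, and let $\sigma_1^2\ge\dots\ge\sigma_d^2$ be the eigenvalues of $\Sigma$, repeated with multiplicity. Let $\mathbb E_\mu(f\mid\sigma(P_r))$ be the conditional expectation of $f$ under $\mu$ given the $\sigma$-algebra generated by the map $x\mapsto P_r x$. Then $f-\mathbb E_\mu(f\mid\sigma(P_r))\in\mathcal H$ and $$\big\|f-\mathbb E_\mu(f\mid\sigma(P_r))\big\|_{\mathcal H}^2\;\le\;\sum_{i=r+1}^d\lambda_i\;\le\;L^2\sum_{i=r+1}^d\sigma_i^2 .$$ -/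

import Mathlib

noncomputable section

namespace RidgeApprox

open MeasureTheory ProbabilityTheory Matrix
open scoped MatrixOrder

/-- `ℝᵏ` with its canonical (Euclidean) norm. -/
abbrev Eu (k : ℕ) : Type := EuclideanSpace ℝ (Fin k)

/-- The norm `‖v‖_V = √(vᵀ R v)` on `V = ℝⁿ`. -/
def vNorm {n : ℕ} (R : Matrix (Fin n) (Fin n) ℝ) (v : Eu n) : ℝ :=
  Real.sqrt (v.ofLp ⬝ᵥ (R *ᵥ v.ofLp))

/-- Membership in `L²(ℝᵈ, μ; V)`: measurable up to a null set, with `∫ ‖u‖_V² dμ < ∞`. -/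
def MemH {d n : ℕ} (R : Matrix (Fin n) (Fin n) ℝ) (μ : Measure (Eu d)) (u : Eu d → Eu n) : Prop :=
  AEStronglyMeasurable u μ ∧ Integrable (fun x => vNorm R (u x) ^ 2) μ

/-- The norm of `L²(ℝᵈ, μ; V)`. It is meant for functions `u` with `MemH R μ u`. -/
def hNorm {d n : ℕ} (R : Matrix (Fin n) (Fin n) ℝ) (μ : Measure (Eu d)) (u : Eu d → Eu n) : ℝ :=
  Real.sqrt (∫ x, vNorm R (u x) ^ 2 ∂μ)

/-- The Jacobian matrix `(∂fᵢ/∂xⱼ)(x)`, for `f` differentiable at `x`. -/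
def jacobian {d n : ℕ} (f : Eu d → Eu n) (x : Eu d) : Matrix (Fin n) (Fin d) ℝ :=
  Matrix.of fun i j => (fderiv ℝ f x (EuclideanSpace.single j 1)).ofLp i

/-- The matrix `H = ∫ (∇f)ᵀ R (∇f) dμ` (entrywise integral). -/
def gradMatrix {d n : ℕ} (R : Matrix (Fin n) (Fin n) ℝ) (μ : Measure (Eu d)) (f : Eu d → Eu n) :
    Matrix (Fin d) (Fin d) ℝ :=
  Matrix.of fun i j => ∫ x, ((jacobian f x)ᵀ * R * jacobian f x) i j ∂μ

/-- A rank-`r` projector: an idempotent matrix (not necessarily symmetric) of rank `r`. -/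
def IsProjector {d : ℕ} (r : ℕ) (P : Matrix (Fin d) (Fin d) ℝ) : Prop :=
  P * P = P ∧ P.rank = r

/-- The bound `trace (S (I - Pᵀ) H (I - P))`. -/
def poincareBound {d : ℕ} (S H P : Matrix (Fin d) (Fin d) ℝ) : ℝ :=
  (S * (1 - Pᵀ) * H * (1 - P)).trace

/-- `P` minimizes `poincareBound S H` among all rank-`r` projectors. -/
def IsOptimalProjector {d : ℕ} (r : ℕ) (S H P : Matrix (Fin d) (Fin d) ℝ) : Prop :=
  IsProjector r P ∧ ∀ Q, IsProjector r Q → poincareBound S H P ≤ poincareBound S H Q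

/-- The σ-algebra `σ(P)` on `ℝᵈ` generated by the linear map `x ↦ P x`. -/
abbrev sigmaAlg {d : ℕ} (P : Matrix (Fin d) (Fin d) ℝ) : MeasurableSpace (Eu d) :=
  MeasurableSpace.comap (fun x : Eu d => Matrix.toEuclideanCLM (𝕜 := ℝ) P x) inferInstance

/-- `lam 0 ≥ lam 1 ≥ ⋯ ≥ lam (d - 1)` are the generalized eigenvalues of the pair `(A, M)`
(`A` symmetric, `M` positive definite), repeated according to multiplicity: `A vᵢ = lamᵢ M vᵢ`
for some `M`-orthonormal basis `v` of `ℝᵈ`. -/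
def IsGenEigenvalues {d : ℕ} (A M : Matrix (Fin d) (Fin d) ℝ) (lam : Fin d → ℝ) : Prop :=
  Antitone lam ∧ ∃ v : Fin d → Fin d → ℝ,
    (∀ i j, v i ⬝ᵥ (M *ᵥ v j) = if i = j then 1 else 0) ∧
    ∀ i, A *ᵥ v i = lam i • (M *ᵥ v i)

/-- `H` is symmetric. -/
theorem gradMatrix_isHermitian {d n : ℕ} {R : Matrix (Fin n) (Fin n) ℝ} (hR : R.PosDef)
    (μ : Measure (Eu d)) (f : Eu d → Eu n) : (gradMatrix R μ f).IsHermitian := by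
  have hRt : Rᵀ = R := by simpa using hR.isHermitian.eq
  ext i j
  simp only [gradMatrix, conjTranspose_apply, of_apply, star_trivial]
  congr 1
  funext x
  rw [← transpose_apply ((jacobian f x)ᵀ * R * jacobian f x)]
  simp only [transpose_mul, transpose_transpose, hRt, Matrix.mul_assoc]

/-- Generalized eigenvalues exist for every symmetric `A` and positive definite `M`. -/
theorem exists_isGenEigenvalues {d : ℕ} {A M : Matrix (Fin d) (Fin d) ℝ} (hA : A.IsHermitian)
    (hM : M.PosDef) : ∃ lam, IsGenEigenvalues A M lam := by
  obtain ⟨B, hB⟩ := CStarAlgebra.nonneg_iff_eq_star_mul_self.mp hM.posSemidef.nonneg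
  have hMB : M = Bᵀ * B := by simpa [Matrix.star_eq_conjTranspose] using hB
  have hBu : IsUnit B := by
    have h := (Matrix.isUnit_iff_isUnit_det _).mp hM.isUnit
    rw [hMB, Matrix.det_mul] at h
    exact (Matrix.isUnit_iff_isUnit_det _).mpr (isUnit_of_mul_isUnit_right h)
  have hBC : B * B⁻¹ = 1 := Matrix.mul_nonsing_inv _ ((Matrix.isUnit_iff_isUnit_det _).mp hBu)
  have hCt : Bᵀ * (B⁻¹)ᵀ = 1 := by
    rw [← Matrix.transpose_mul, Matrix.nonsing_inv_mul _ ((Matrix.isUnit_iff_isUnit_det _).mp hBu),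
      Matrix.transpose_one]
  have hK : ((B⁻¹)ᵀ * A * B⁻¹).IsHermitian := by
    simpa using Matrix.isHermitian_conjTranspose_mul_mul B⁻¹ hA
  have hT := Matrix.isSymmetric_toEuclideanLin_iff.mpr hK
  have hn : Module.finrank ℝ (EuclideanSpace ℝ (Fin d)) = d := finrank_euclideanSpace_fin
  refine ⟨hT.eigenvalues hn, hT.eigenvalues_antitone hn,
    fun i => B⁻¹ *ᵥ (hT.eigenvectorBasis hn i).ofLp, fun i j => ?_, fun i => ?_⟩
  · have h := orthonormal_iff_ite.mp (hT.eigenvectorBasis hn).orthonormal i j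
    rw [← h, hMB, ← Matrix.mulVec_mulVec, Matrix.mulVec_mulVec _ B, hBC, Matrix.one_mulVec,
      Matrix.mulVec_transpose, dotProduct_comm, ← Matrix.dotProduct_mulVec, Matrix.mulVec_mulVec,
      hBC, Matrix.one_mulVec, EuclideanSpace.inner_eq_star_dotProduct, star_trivial]
  · have h : ((B⁻¹)ᵀ * A * B⁻¹) *ᵥ (hT.eigenvectorBasis hn i).ofLp =
        hT.eigenvalues hn i • (hT.eigenvectorBasis hn i).ofLp :=
      congrArg WithLp.ofLp (hT.apply_eigenvectorBasis hn i)
    have h2 := congrArg (fun w => Bᵀ *ᵥ w) h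
    simp only [Matrix.mulVec_mulVec, Matrix.mulVec_smul] at h2
    rw [← Matrix.mul_assoc, ← Matrix.mul_assoc, hCt, Matrix.one_mul] at h2
    have hc : M * B⁻¹ = Bᵀ := by rw [hMB, Matrix.mul_assoc, hBC, Matrix.mul_one]
    rw [Matrix.mulVec_mulVec, Matrix.mulVec_mulVec, hc, h2]

end RidgeApprox

end

/-! Write `μ` as the law of `m + A z` with `A = √Σ` and `z` standard Gaussian, and factor `R = BᵀB`,
so that the `V`-norm of `f` is the Euclidean norm of `B f` and its coordinates can be treated one by
one. Let `T` be the orthogonal projection onto the kernel of `A⁻¹PA`. Knowing `P x` amounts to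
knowing `z - T z`, so conditioning averages over `T z` (`gaussianAverage_ae_eq_condExp`).

The analytic core is a Poincaré inequality with constant one,
`integral_sq_sub_integral_decoupled_le`. Rotate `T z` through an angle `θ` into `T z'`, with `z'` an
independent copy of `z`. The correlation `φ(θ) = E[h(z) h(z_θ)]` runs from `E[h²]` at `θ = 0` to the
second moment of the conditional expectation at `θ = π/2`. By Stein's lemma `φ'(θ)` is `-sin θ`
times a correlation of `T∇h` at two standard Gaussian points, and that correlation is at most `C =
E‖T∇h‖²`. Integrating loses at most `C`.

Summed over coordinates, the error is at most `tr((AT)ᵀ H (AT))`. Since `AT = (1 - P)AT`, this is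
the trace of a compression of a positive semidefinite matrix whose own trace is `poincareBound`.
Minimality then allows comparison with the projector onto the leading generalized eigenvectors,
whose bound is the tail sum of the `λᵢ` (`exists_isProjector_poincareBound_eq`). Finally the
Lipschitz bound gives `H ≤ L² I`, and a Courant-Fischer argument gives `λⱼ ≤ L² σⱼ²`
(`genEigenvalue_le`). -/

namespace RidgeApprox

open MeasureTheory ProbabilityTheory Matrix
open scoped MatrixOrder RealInnerProductSpace ENNReal NNReal Gradient

/-! ### One-dimensional integration by parts and rotation invariance -/

section Gaussian

/-- Lipschitz functions have all moments under a Gaussian measure. -/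
lemma memLp_lipschitzWith {E F : Type*} [NormedAddCommGroup E] [NormedSpace ℝ E]
    [CompleteSpace E] [SecondCountableTopology E] [MeasurableSpace E] [BorelSpace E]
    [NormedAddCommGroup F] {ν : Measure E} [IsGaussian ν] {K : ℝ≥0} {h : E → F}
    (hh : LipschitzWith K h) {p : ℝ≥0∞} (hp : p ≠ ∞) : MemLp h p ν := by
  have h1 : MemLp ((fun x => h x - h 0) ∘ id) p ν := by
    refine LipschitzWith.comp_memLp (K := K) (LipschitzWith.of_dist_le_mul fun x y => ?_) (by simp)
      (IsGaussian.memLp_id ν p hp)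
    simpa using hh.dist_le_mul x y
  exact (h1.add (memLp_const (h 0))).ae_eq (ae_of_all _ fun x => by simp)

lemma hasDerivAt_gaussianPDFReal_zero_one (x : ℝ) :
    HasDerivAt (gaussianPDFReal 0 1) (-(x * gaussianPDFReal 0 1 x)) x := by
  have h : HasDerivAt (fun x : ℝ => (√(2 * Real.pi * (1 : ℝ≥0)))⁻¹ *
      Real.exp (-(x - 0) ^ 2 / (2 * (1 : ℝ≥0))))
      ((√(2 * Real.pi * (1 : ℝ≥0)))⁻¹ * (Real.exp (-(x - 0) ^ 2 / (2 * (1 : ℝ≥0))) * (-x))) x := by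
    refine HasDerivAt.const_mul _ (HasDerivAt.exp ?_)
    exact ((((hasDerivAt_id x).sub_const 0).pow 2).neg.div_const (2 * ((1 : ℝ≥0) : ℝ))).congr_deriv
      (by simp [neg_div])
  rw [gaussianPDFReal_def]
  convert h using 1
  ring

lemma integrable_gaussianPDFReal_mul {u : ℝ → ℝ} (hu : Integrable u (gaussianReal 0 1)) :
    Integrable (fun x => gaussianPDFReal 0 1 x * u x) := by
  rw [gaussianReal_of_var_ne_zero _ one_ne_zero,
    integrable_withDensity_iff_integrable_smul' (measurable_gaussianPDF _ _)
      (ae_of_all _ fun _ => gaussianPDF_lt_top)] at hu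
  simpa using hu

/-- Gaussian integration by parts on the line. -/
lemma integral_mul_id_gaussianReal {u u' : ℝ → ℝ} (hu : ∀ x, HasDerivAt u (u' x) x)
    (hi : Integrable u (gaussianReal 0 1)) (hi' : Integrable u' (gaussianReal 0 1))
    (hix : Integrable (fun x => u x * x) (gaussianReal 0 1)) :
    ∫ x, u x * x ∂(gaussianReal 0 1) = ∫ x, u' x ∂(gaussianReal 0 1) := by
  rw [integral_gaussianReal_eq_integral_smul one_ne_zero,
    integral_gaussianReal_eq_integral_smul one_ne_zero]
  have h := integral_mul_deriv_eq_deriv_mul_of_integrable (u := u) (u' := u')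
    (v := gaussianPDFReal 0 1) (v' := fun x => -(x * gaussianPDFReal 0 1 x))
    (fun x _ => hu x) (fun x _ => hasDerivAt_gaussianPDFReal_zero_one x)
    ((integrable_gaussianPDFReal_mul hix).neg.congr (ae_of_all _ fun x => by
      simp only [Pi.neg_apply, Pi.mul_apply]; ring))
    ((integrable_gaussianPDFReal_mul hi').congr (ae_of_all _ fun x => mul_comm _ _))
    ((integrable_gaussianPDFReal_mul hi).congr (ae_of_all _ fun x => mul_comm _ _))
  have h2 : ∫ x, u x * -(x * gaussianPDFReal 0 1 x) =
      -∫ x, gaussianPDFReal 0 1 x • (u x * x) := by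
    rw [← integral_neg]
    congr with x
    simp only [smul_eq_mul]
    ring
  rw [h2] at h
  rw [neg_inj.mp h]
  congr with x
  simp only [smul_eq_mul, mul_comm]

variable {E : Type*} [NormedAddCommGroup E] [InnerProductSpace ℝ E] [FiniteDimensional ℝ E]
  [MeasurableSpace E] [BorelSpace E]

/-- Rotations of a pair of independent standard Gaussian vectors. -/
lemma measurePreserving_rotation {A B : E →L[ℝ] E} (hA : ∀ x y, ⟪A x, y⟫ = ⟪x, A y⟫)
    (hB : ∀ x y, ⟪B x, y⟫ = ⟪x, B y⟫) (hAB : ∀ x, A (B x) = B (A x))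
    (h1 : ∀ x, A (A x) + B (B x) = x) :
    MeasurePreserving (fun p : E × E => (A p.1 + B p.2, A p.2 - B p.1))
      ((stdGaussian E).prod (stdGaussian E)) ((stdGaussian E).prod (stdGaussian E)) := by
  refine ⟨by fun_prop, ?_⟩
  let U : E × E →L[ℝ] E × E :=
    (A.comp (.fst ℝ E E) + B.comp (.snd ℝ E E)).prod (A.comp (.snd ℝ E E) - B.comp (.fst ℝ E E))
  change Measure.map U _ = _
  refine Measure.ext_of_charFunDual ?_
  ext L
  rw [charFunDual_map, charFunDual_prod, charFunDual_prod]
  -- A functional on the pair is a pair of vectors `(a, b)`; the rotation sends it to `(A a - B b, B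
  -- a + A b)`. The Gaussian characteristic function only sees the total squared length, which `key`
  -- shows to be unchanged.
  obtain ⟨a, ha⟩ := (InnerProductSpace.toDual ℝ E).surjective (L.comp (.inl ℝ E E))
  obtain ⟨b, hb⟩ := (InnerProductSpace.toDual ℝ E).surjective (L.comp (.inr ℝ E E))
  have hL : ∀ x y, L (x, y) = ⟪a, x⟫ + ⟪b, y⟫ := fun x y => by
    have h1 : ⟪a, x⟫ = L (x, 0) := by simpa using DFunLike.congr_fun ha x
    have h2 : ⟪b, y⟫ = L (0, y) := by simpa using DFunLike.congr_fun hb y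
    rw [h1, h2, ← map_add]
    simp
  have e1 : (L.comp U).comp (.inl ℝ E E) = InnerProductSpace.toDual ℝ E (A a - B b) := by
    ext x
    simp [U, hL, hA, hB, sub_eq_add_neg]
  have e2 : (L.comp U).comp (.inr ℝ E E) = InnerProductSpace.toDual ℝ E (B a + A b) := by
    ext x
    simp [U, hL, hA, hB]
  rw [e1, e2, ← ha, ← hb]
  simp only [charFunDual_stdGaussian, LinearIsometryEquiv.norm_map, ← Complex.exp_add]
  congr 1
  have key : ‖A a - B b‖ ^ 2 + ‖B a + A b‖ ^ 2 = ‖a‖ ^ 2 + ‖b‖ ^ 2 := by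
    have k1 : ∀ x, ‖A x‖ ^ 2 + ‖B x‖ ^ 2 = ‖x‖ ^ 2 := fun x => by
      rw [← real_inner_self_eq_norm_sq, ← real_inner_self_eq_norm_sq,
        ← real_inner_self_eq_norm_sq, hA, hB, ← inner_add_right, h1]
    have k2 : ⟪A a, B b⟫ = ⟪B a, A b⟫ := by rw [hA, hB, hAB]
    rw [@norm_sub_sq ℝ, @norm_add_sq ℝ, ← k1 a, ← k1 b]
    simp only [RCLike.re_to_real, k2]
    ring
  rw [← add_div, ← add_div, ← neg_add, ← neg_add]
  exact_mod_cast congrArg (fun t : ℝ => ((-t : ℝ) : ℂ) / 2) key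

end Gaussian

/-! ### Stein's lemma -/

section Gaussian

variable {E : Type*} [NormedAddCommGroup E] [InnerProductSpace ℝ E] [FiniteDimensional ℝ E]
  [MeasurableSpace E] [BorelSpace E]

lemma integral_comp_measurePreserving {α β : Type*} [MeasurableSpace α] [MeasurableSpace β]
    {μ : Measure α} {ν : Measure β} {φ : α → β} (hφ : MeasurePreserving φ μ ν) {g : β → ℝ}
    (hg : AEStronglyMeasurable g ν) : ∫ x, g (φ x) ∂μ = ∫ y, g y ∂ν := by
  rw [← hφ.map_eq, integral_map hφ.measurable.aemeasurable (by rwa [hφ.map_eq])]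

lemma map_inner_stdGaussian {w : E} (hw : ‖w‖ = 1) :
    MeasurePreserving (fun z : E => ⟪w, z⟫) (stdGaussian E) (gaussianReal 0 1) := by
  refine ⟨by fun_prop, ?_⟩
  have h := IsGaussian.map_eq_gaussianReal (μ := stdGaussian E) (innerSL ℝ w)
  rw [variance_dual_stdGaussian, integral_strongDual_stdGaussian] at h
  simpa [hw] using! h

lemma integrable_mul_lipschitzWith {F : Type*} [NormedAddCommGroup F] [NormedSpace ℝ F]
    [CompleteSpace F] [SecondCountableTopology F] [MeasurableSpace F] [BorelSpace F]
    {ν : Measure F} [IsGaussian ν] {K K' : ℝ≥0} {g h : F → ℝ}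
    (hg : LipschitzWith K g) (hh : LipschitzWith K' h) : Integrable (fun x => g x * h x) ν :=
  (memLp_lipschitzWith hg (p := 2) ENNReal.ofNat_ne_top).integrable_mul
    (memLp_lipschitzWith hh (p := 2) ENNReal.ofNat_ne_top)

/-- Split off the line spanned by `w`: replace `z` by `A x + B y`, where `x`, `y` are independent,
`B` projects onto that line and `A = 1 - B`. With `x` frozen, only the standard real Gaussian `⟪w,
y⟫` remains, and the one-dimensional formula applies. -/
lemma integral_mul_inner_stdGaussian_of_norm_eq_one {h : E → ℝ} {K : ℝ≥0} (hd : ContDiff ℝ 1 h)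
    (hh : LipschitzWith K h) {w : E} (hw : ‖w‖ = 1) :
    ∫ z, h z * ⟪w, z⟫ ∂(stdGaussian E) = ∫ z, fderiv ℝ h z w ∂(stdGaussian E) := by
  let B : E →L[ℝ] E := (innerSL ℝ w).smulRight w
  let A : E →L[ℝ] E := .id ℝ E - B
  have hBx : ∀ x, B x = ⟪w, x⟫ • w := fun x => by simp [B]
  have hAx : ∀ x, A x = x - ⟪w, x⟫ • w := fun x => by simp [A, hBx]
  have hrot : MeasurePreserving (fun p : E × E => A p.1 + B p.2)
      ((stdGaussian E).prod (stdGaussian E)) (stdGaussian E) := by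
    refine measurePreserving_fst.comp (measurePreserving_rotation (A := A) (B := B) ?_ ?_ ?_ ?_)
    · intro x y
      simp only [hAx, inner_sub_left, inner_sub_right, real_inner_smul_left, real_inner_smul_right,
        real_inner_comm w]
      ring
    · intro x y
      simp only [hBx, real_inner_smul_left, real_inner_smul_right, real_inner_comm w]
      ring
    · intro x
      simp [hAx, hBx, inner_sub_right, real_inner_smul_right, hw]
    · intro x
      simp [hAx, hBx, inner_sub_right, real_inner_smul_right, hw]
  have hcd : Continuous (fun z => fderiv ℝ h z w) :=
    (hd.continuous_fderiv one_ne_zero).clm_apply continuous_const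
  have hbd : ∀ z, ‖fderiv ℝ h z w‖ ≤ K := fun z => by
    have := (fderiv ℝ h z).le_of_opNorm_le (norm_fderiv_le_of_lipschitz ℝ hh) w
    rwa [hw, mul_one] at this
  have hinner : LipschitzWith ‖innerSL ℝ w‖₊ (fun z : E => ⟪w, z⟫) := (innerSL ℝ w).lipschitz
  have hi : Integrable (fun z => h z * ⟪w, z⟫) (stdGaussian E) :=
    integrable_mul_lipschitzWith hh hinner
  have hi' : Integrable (fun z => fderiv ℝ h z w) (stdGaussian E) :=
    Integrable.of_bound hcd.aestronglyMeasurable K (ae_of_all _ hbd)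
  rw [← integral_comp_measurePreserving hrot hi.1, ← integral_comp_measurePreserving hrot hi'.1,
    integral_prod (fun p : E × E => h (A p.1 + B p.2) * ⟪w, A p.1 + B p.2⟫)
      (hrot.integrable_comp_of_integrable hi),
    integral_prod (fun p : E × E => fderiv ℝ h (A p.1 + B p.2) w)
      (hrot.integrable_comp_of_integrable hi')]
  congr with x
  have hAB : ∀ y, ⟪w, A x + B y⟫ = ⟪w, y⟫ := fun y => by
    simp [hAx, hBx, inner_add_right, inner_sub_right, real_inner_smul_right, hw]
  have hline : ∀ t : ℝ, HasDerivAt (fun t : ℝ => h (A x + t • w))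
      (fderiv ℝ h (A x + t • w) w) t := fun t => by
    have h1 : HasDerivAt (fun t : ℝ => A x + t • w) w t := by
      simpa using ((hasDerivAt_id t).smul_const w).const_add (A x)
    exact (hd.differentiable one_ne_zero _).hasFDerivAt.comp_hasDerivAt t h1
  have hlip : LipschitzWith (K * ‖w‖₊) (fun t : ℝ => h (A x + t • w)) :=
    hh.comp (LipschitzWith.of_dist_le_mul fun s t => by
      simp [dist_eq_norm, ← sub_smul, norm_smul, mul_comm])
  have hcl : Continuous (fun t : ℝ => fderiv ℝ h (A x + t • w) w) := hcd.comp (by fun_prop)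
  calc ∫ y, h (A x + B y) * ⟪w, A x + B y⟫ ∂(stdGaussian E)
      = ∫ y, (fun t : ℝ => h (A x + t • w) * t) ⟪w, y⟫ ∂(stdGaussian E) := by
        simp only [hAB]
        simp only [hBx]
    _ = ∫ t, h (A x + t • w) * t ∂(gaussianReal 0 1) :=
        integral_comp_measurePreserving (map_inner_stdGaussian hw)
          (hlip.continuous.mul continuous_id).aestronglyMeasurable
    _ = ∫ t, fderiv ℝ h (A x + t • w) w ∂(gaussianReal 0 1) :=
        integral_mul_id_gaussianReal hline
          ((memLp_lipschitzWith hlip ENNReal.one_ne_top).integrable le_rfl)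
          (Integrable.of_bound hcl.aestronglyMeasurable K (ae_of_all _ fun _ => hbd _))
          (integrable_mul_lipschitzWith hlip LipschitzWith.id)
    _ = ∫ y, (fun t : ℝ => fderiv ℝ h (A x + t • w) w) ⟪w, y⟫ ∂(stdGaussian E) :=
        (integral_comp_measurePreserving (map_inner_stdGaussian hw)
          hcl.aestronglyMeasurable).symm
    _ = ∫ y, fderiv ℝ h (A x + B y) w ∂(stdGaussian E) := by simp only [hBx]

/-- Gaussian integration by parts (Stein's lemma). -/
lemma integral_mul_inner_stdGaussian {h : E → ℝ} {K : ℝ≥0} (hd : ContDiff ℝ 1 h)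
    (hh : LipschitzWith K h) (w : E) :
    ∫ z, h z * ⟪w, z⟫ ∂(stdGaussian E) = ∫ z, fderiv ℝ h z w ∂(stdGaussian E) := by
  rcases eq_or_ne w 0 with rfl | hw
  · simp
  · have hn : ‖w‖ ≠ 0 := norm_ne_zero_iff.mpr hw
    have hu : ‖‖w‖⁻¹ • w‖ = 1 := by rw [norm_smul, norm_inv, norm_norm, inv_mul_cancel₀ hn]
    have h1 := integral_mul_inner_stdGaussian_of_norm_eq_one hd hh hu
    simp only [real_inner_smul_left, map_smul, smul_eq_mul, mul_left_comm _ ‖w‖⁻¹] at h1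
    rw [integral_const_mul, integral_const_mul] at h1
    exact mul_left_cancel₀ (inv_ne_zero hn) h1

end Gaussian

/-! ### Interpolation by rotation and the Poincaré inequality -/

section Gaussian

set_option linter.unusedSectionVars false

variable {E : Type*} [NormedAddCommGroup E] [InnerProductSpace ℝ E] [FiniteDimensional ℝ E]
  [MeasurableSpace E] [BorelSpace E]

/-- For a projection `T`: `cos θ` on its range and the identity on its kernel. -/
noncomputable def cosPart (T : E →L[ℝ] E) (θ : ℝ) : E →L[ℝ] E := .id ℝ E - T + Real.cos θ • T

/-- For a projection `T`: `sin θ` on its range and zero on its kernel. -/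
noncomputable def sinPart (T : E →L[ℝ] E) (θ : ℝ) : E →L[ℝ] E := Real.sin θ • T

lemma cosPart_apply (T : E →L[ℝ] E) (θ : ℝ) (x : E) :
    cosPart T θ x = x - T x + Real.cos θ • T x := by simp [cosPart]

lemma sinPart_apply (T : E →L[ℝ] E) (θ : ℝ) (x : E) : sinPart T θ x = Real.sin θ • T x := by
  simp [sinPart]

/-- The squares of the two parts add up to the identity by `cos² + sin² = 1` on the range of `T`.
The whole pair is kept because its second entry carries the velocity of the path. -/
lemma measurePreserving_cosPart_sinPart {T : E →L[ℝ] E} (hT : ∀ x y, ⟪T x, y⟫ = ⟪x, T y⟫)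
    (hTT : ∀ x, T (T x) = T x) (θ : ℝ) :
    MeasurePreserving (fun p : E × E => (cosPart T θ p.1 + sinPart T θ p.2,
      cosPart T θ p.2 - sinPart T θ p.1))
      ((stdGaussian E).prod (stdGaussian E)) ((stdGaussian E).prod (stdGaussian E)) := by
  refine measurePreserving_rotation (fun x y => ?_) (fun x y => ?_) (fun x => ?_) (fun x => ?_)
  · simp only [cosPart_apply, inner_add_left, inner_sub_left, inner_add_right, inner_sub_right,
      real_inner_smul_left, real_inner_smul_right, hT]
  · simp only [sinPart_apply, real_inner_smul_left, real_inner_smul_right, hT]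
  · simp [cosPart_apply, sinPart_apply, hTT, smul_smul, mul_comm]
  · simp only [cosPart_apply, sinPart_apply, map_add, map_sub, map_smul, hTT, smul_smul, sub_self,
      zero_add, add_assoc, ← add_smul, ← sq]
    simp

lemma measurePreserving_cosPart_add_sinPart {T : E →L[ℝ] E} (hT : ∀ x y, ⟪T x, y⟫ = ⟪x, T y⟫)
    (hTT : ∀ x, T (T x) = T x) (θ : ℝ) :
    MeasurePreserving (fun p : E × E => cosPart T θ p.1 + sinPart T θ p.2)
      ((stdGaussian E).prod (stdGaussian E)) (stdGaussian E) :=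
  measurePreserving_fst.comp (measurePreserving_cosPart_sinPart hT hTT θ)

lemma lipschitzWith_comp_clm {F : Type*} [NormedAddCommGroup F] [NormedSpace ℝ F]
    {h : E → ℝ} {K : ℝ≥0} (hh : LipschitzWith K h) (U : F →L[ℝ] E) :
    LipschitzWith (K * ‖U‖₊) (fun p => h (U p)) := hh.comp U.lipschitz

/-- Differentiation under the integral: since `|cos|, |sin| ≤ 1`, the bound `|h(p₁)| K (‖T p₂‖ + ‖T
p₁‖)` dominates the derivative for all angles at once, and it is a product of two square-integrable
functions. -/
lemma hasDerivAt_integral_mul_comp_path {h : E → ℝ} {K : ℝ≥0} (hd : ContDiff ℝ 1 h)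
    (hh : LipschitzWith K h) (T : E →L[ℝ] E) (θ : ℝ) :
    HasDerivAt (fun θ => ∫ p : E × E, h p.1 * h (cosPart T θ p.1 + sinPart T θ p.2)
        ∂((stdGaussian E).prod (stdGaussian E)))
      (∫ p : E × E, h p.1 * fderiv ℝ h (cosPart T θ p.1 + sinPart T θ p.2)
          (Real.cos θ • T p.2 - Real.sin θ • T p.1)
        ∂((stdGaussian E).prod (stdGaussian E))) θ := by
  have hc : Continuous h := hh.continuous
  have hcd : Continuous (fderiv ℝ h) := hd.continuous_fderiv one_ne_zero
  have l1 : LipschitzWith (K * _) (fun p : E × E => h p.1) :=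
    lipschitzWith_comp_clm hh (.fst ℝ E E)
  have l2 : ∀ θ, LipschitzWith (K * _)
      (fun p : E × E => h (cosPart T θ p.1 + sinPart T θ p.2)) := fun θ =>
    lipschitzWith_comp_clm hh ((cosPart T θ).comp (.fst ℝ E E) + (sinPart T θ).comp (.snd ℝ E E))
  have lT1 : MemLp (fun p : E × E => T p.1) 2 ((stdGaussian E).prod (stdGaussian E)) :=
    memLp_lipschitzWith (T.comp (.fst ℝ E E)).lipschitz ENNReal.ofNat_ne_top
  have lT2 : MemLp (fun p : E × E => T p.2) 2 ((stdGaussian E).prod (stdGaussian E)) :=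
    memLp_lipschitzWith (T.comp (.snd ℝ E E)).lipschitz ENNReal.ofNat_ne_top
  have hb : Integrable (fun p : E × E => ‖h p.1‖ * (K * (‖T p.2‖ + ‖T p.1‖)))
      ((stdGaussian E).prod (stdGaussian E)) :=
    (memLp_lipschitzWith l1 (p := 2) ENNReal.ofNat_ne_top).norm.integrable_mul
      ((lT2.norm.add lT1.norm).const_mul K)
  refine (hasDerivAt_integral_of_dominated_loc_of_deriv_le
    (F := fun θ (p : E × E) => h p.1 * h (cosPart T θ p.1 + sinPart T θ p.2))
    (F' := fun θ (p : E × E) => h p.1 * fderiv ℝ h (cosPart T θ p.1 + sinPart T θ p.2)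
          (Real.cos θ • T p.2 - Real.sin θ • T p.1)) Filter.univ_mem
    (Filter.Eventually.of_forall fun θ => ?_) (integrable_mul_lipschitzWith l1 (l2 θ)) ?_
    (ae_of_all _ fun p θ _ => ?_) hb (ae_of_all _ fun p θ _ => ?_)).2
  · exact ((l1.continuous).mul (l2 θ).continuous).aestronglyMeasurable
  · refine Continuous.aestronglyMeasurable (l1.continuous.mul ((hcd.comp ?_).clm_apply ?_))
    all_goals fun_prop
  · rw [norm_mul]
    gcongr
    refine ((fderiv ℝ h _).le_of_opNorm_le (norm_fderiv_le_of_lipschitz ℝ hh) _).trans ?_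
    gcongr
    refine (norm_sub_le _ _).trans (add_le_add ?_ ?_)
    · rw [norm_smul]
      exact mul_le_of_le_one_left (norm_nonneg _) (Real.abs_cos_le_one θ)
    · rw [norm_smul]
      exact mul_le_of_le_one_left (norm_nonneg _) (Real.abs_sin_le_one θ)
  · have hx : HasDerivAt (fun θ : ℝ => cosPart T θ p.1 + sinPart T θ p.2)
        (Real.cos θ • T p.2 - Real.sin θ • T p.1) θ := by
      simp only [cosPart_apply, sinPart_apply]
      refine ((((Real.hasDerivAt_cos θ).smul_const (T p.1)).const_add (p.1 - T p.1)).add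
        ((Real.hasDerivAt_sin θ).smul_const (T p.2))).congr_deriv ?_
      rw [neg_smul]
      abel
    exact ((hd.differentiable one_ne_zero _).hasFDerivAt.comp_hasDerivAt θ hx).const_mul _

lemma continuous_gradient {h : E → ℝ} (hd : ContDiff ℝ 1 h) : Continuous (∇ h) :=
  (InnerProductSpace.toDual ℝ E).symm.continuous.comp (hd.continuous_fderiv one_ne_zero)

lemma norm_gradient_le {h : E → ℝ} {K : ℝ≥0} (hh : LipschitzWith K h) (x : E) :
    ‖∇ h x‖ ≤ K := by
  rw [← (InnerProductSpace.toDual ℝ E).norm_map, toDual_gradient]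
  exact norm_fderiv_le_of_lipschitz ℝ hh

lemma integrable_inner_gradient_path {h : E → ℝ} {K : ℝ≥0} (hd : ContDiff ℝ 1 h)
    (hh : LipschitzWith K h) (T : E →L[ℝ] E) (θ : ℝ) :
    Integrable (fun p : E × E => ⟪T (∇ h (cosPart T θ p.1 - sinPart T θ p.2)),
      T (∇ h p.1)⟫) ((stdGaussian E).prod (stdGaussian E)) := by
  have hcg := continuous_gradient hd
  refine Integrable.of_bound (Continuous.aestronglyMeasurable (by fun_prop))
    (‖T‖ * K * (‖T‖ * K)) (ae_of_all _ fun p => ?_)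
  refine (norm_inner_le_norm _ _).trans ?_
  gcongr <;> exact T.le_opNorm_of_le (norm_gradient_le hh _)

/-- In the rotated coordinates `q`, the path point is `q₁`, its velocity is `T q₂`, and the starting
point is `cosPart q₁ - sinPart q₂`. The integrand is therefore linear in `q₂` apart from the factor
`h`, and Stein's lemma in `q₂`, with direction `T∇h(q₁)`, produces the factor `-sin θ`. -/
lemma integral_mul_fderiv_path {h : E → ℝ} {K : ℝ≥0} (hd : ContDiff ℝ 1 h)
    (hh : LipschitzWith K h) {T : E →L[ℝ] E} (hT : ∀ x y, ⟪T x, y⟫ = ⟪x, T y⟫)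
    (hTT : ∀ x, T (T x) = T x) (θ : ℝ) :
    ∫ p : E × E, h p.1 * fderiv ℝ h (cosPart T θ p.1 + sinPart T θ p.2)
          (Real.cos θ • T p.2 - Real.sin θ • T p.1) ∂((stdGaussian E).prod (stdGaussian E)) =
      -(Real.sin θ * ∫ p : E × E, ⟪T (∇ h (cosPart T θ p.1 - sinPart T θ p.2)), T (∇ h p.1)⟫
        ∂((stdGaussian E).prod (stdGaussian E))) := by
  have hcg := continuous_gradient hd
  have hg : ∀ x v, fderiv ℝ h x v = ⟪∇ h x, v⟫ := fun x v => by
    rw [← toDual_gradient, InnerProductSpace.toDual_apply_apply]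
  have hnT : ∀ x, ‖T (∇ h x)‖ ≤ ‖T‖ * K := fun x => T.le_opNorm_of_le (norm_gradient_le hh x)
  have l1 : LipschitzWith (K * _) (fun p : E × E => h (cosPart T θ p.1 - sinPart T θ p.2)) :=
    lipschitzWith_comp_clm hh ((cosPart T θ).comp (.fst ℝ E E) - (sinPart T θ).comp (.snd ℝ E E))
  have m2 : MemLp (fun p : E × E => p.2) 2 ((stdGaussian E).prod (stdGaussian E)) :=
    memLp_lipschitzWith (ContinuousLinearMap.snd ℝ E E).lipschitz ENNReal.ofNat_ne_top
  have m3 : MemLp (fun p : E × E => ⟪T (∇ h p.1), p.2⟫) 2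
      ((stdGaussian E).prod (stdGaussian E)) := by
    refine m2.of_le_mul (c := ‖T‖ * K)
      (Continuous.aestronglyMeasurable (by fun_prop)) (ae_of_all _ fun p => ?_)
    refine (norm_inner_le_norm _ _).trans ?_
    gcongr
    exact hnT _
  have i1 : Integrable (fun p : E × E => h (cosPart T θ p.1 - sinPart T θ p.2) *
      ⟪T (∇ h p.1), p.2⟫) ((stdGaussian E).prod (stdGaussian E)) :=
    (memLp_lipschitzWith l1 (p := 2) ENNReal.ofNat_ne_top).integrable_mul m3
  have i2 := integrable_inner_gradient_path hd hh T θ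
  have e1 : ∀ p : E × E, h p.1 * fderiv ℝ h (cosPart T θ p.1 + sinPart T θ p.2)
          (Real.cos θ • T p.2 - Real.sin θ • T p.1) =
      (fun q : E × E => h (cosPart T θ q.1 - sinPart T θ q.2) * ⟪T (∇ h q.1), q.2⟫)
        (cosPart T θ p.1 + sinPart T θ p.2, cosPart T θ p.2 - sinPart T θ p.1) := by
    intro p
    have a1 : cosPart T θ (cosPart T θ p.1 + sinPart T θ p.2) -
        sinPart T θ (cosPart T θ p.2 - sinPart T θ p.1) = p.1 := by
      simp only [cosPart_apply, sinPart_apply, map_add, map_sub, map_smul, hTT, smul_smul,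
        smul_add, smul_sub]
      linear_combination (norm := module) (Real.cos_sq_add_sin_sq θ) • T p.1
    have a2 : T (cosPart T θ p.2 - sinPart T θ p.1) = Real.cos θ • T p.2 - Real.sin θ • T p.1 := by
      simp [cosPart_apply, sinPart_apply, hTT]
    simp only [a1, hg, hT, a2]
  simp only [e1]
  rw [integral_comp_measurePreserving (measurePreserving_cosPart_sinPart hT hTT θ) i1.1,
    integral_prod _ i1, integral_prod _ i2, ← integral_const_mul, ← integral_neg]
  congr with x
  have hd' : ContDiff ℝ 1 (fun y => h (cosPart T θ x - sinPart T θ y)) :=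
    hd.comp (by fun_prop)
  have hh' : LipschitzWith (K * _) (fun y => h (cosPart T θ x - sinPart T θ y)) :=
    hh.comp ((LipschitzWith.const _).sub (sinPart T θ).lipschitz)
  change ∫ y, h (cosPart T θ x - sinPart T θ y) * ⟪T (∇ h x), y⟫ ∂(stdGaussian E) = _
  rw [integral_mul_inner_stdGaussian hd' hh', ← integral_const_mul, ← integral_neg]
  congr with y
  have hy : HasFDerivAt (fun y => cosPart T θ x - sinPart T θ y) (-sinPart T θ) y :=
    (sinPart T θ).hasFDerivAt.const_sub _
  have hf := (hd.differentiable one_ne_zero (cosPart T θ x - sinPart T θ y)).hasFDerivAt.comp y hy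
  change fderiv ℝ (h ∘ fun y => cosPart T θ x - sinPart T θ y) y _ = _
  rw [hf.fderiv]
  change fderiv ℝ h _ (-(sinPart T θ (T (∇ h x)))) = _
  rw [map_neg, sinPart_apply T θ (T _), map_smul, hg, hT _ (T _), smul_eq_mul]

/-- A Poincaré inequality for the standard Gaussian measure along the range of the orthogonal
projection `T`, with the second moment of the conditional expectation in decoupled form. -/
lemma integral_sq_sub_integral_decoupled_le {h : E → ℝ} {K : ℝ≥0} (hd : ContDiff ℝ 1 h)
    (hh : LipschitzWith K h) {T : E →L[ℝ] E} (hT : ∀ x y, ⟪T x, y⟫ = ⟪x, T y⟫)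
    (hTT : ∀ x, T (T x) = T x) :
    ∫ x, h x ^ 2 ∂(stdGaussian E) -
        ∫ p : E × E, h p.1 * h (p.1 - T p.1 + T p.2) ∂((stdGaussian E).prod (stdGaussian E)) ≤
      ∫ x, ‖T (∇ h x)‖ ^ 2 ∂(stdGaussian E) := by
  have hcg := continuous_gradient hd
  have hnT : ∀ x, ‖T (∇ h x)‖ ≤ ‖T‖ * K := fun x => T.le_opNorm_of_le (norm_gradient_le hh x)
  set C := ∫ x, ‖T (∇ h x)‖ ^ 2 ∂(stdGaussian E)
  have hCi : Integrable (fun x => ‖T (∇ h x)‖ ^ 2) (stdGaussian E) :=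
    Integrable.of_bound (Continuous.aestronglyMeasurable (by fun_prop)) ((‖T‖ * K) ^ 2)
      (ae_of_all _ fun x => by
        rw [Real.norm_of_nonneg (by positivity)]
        gcongr
        exact hnT x)
  -- The minus sign is rotation by `-θ`.
  have hmp : ∀ θ, MeasurePreserving (fun p : E × E => cosPart T θ p.1 - sinPart T θ p.2)
      ((stdGaussian E).prod (stdGaussian E)) (stdGaussian E) := fun θ => by
    have := measurePreserving_cosPart_add_sinPart hT hTT (-θ)
    simpa [cosPart, sinPart, sub_eq_add_neg] using this
  have hle : ∀ θ, ∫ p : E × E, ⟪T (∇ h (cosPart T θ p.1 - sinPart T θ p.2)), T (∇ h p.1)⟫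
        ∂((stdGaussian E).prod (stdGaussian E)) ≤ C := fun θ => by
    have j1 : Integrable (fun p : E × E => ‖T (∇ h (cosPart T θ p.1 - sinPart T θ p.2))‖ ^ 2)
        ((stdGaussian E).prod (stdGaussian E)) := (hmp θ).integrable_comp_of_integrable hCi
    have j2 : Integrable (fun p : E × E => ‖T (∇ h p.1)‖ ^ 2)
        ((stdGaussian E).prod (stdGaussian E)) := (measurePreserving_fst (μ := stdGaussian E) (ν := stdGaussian E)
      ).integrable_comp_of_integrable hCi
    have j3 : ∫ p : E × E, ‖T (∇ h (cosPart T θ p.1 - sinPart T θ p.2))‖ ^ 2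
        ∂((stdGaussian E).prod (stdGaussian E)) = C :=
      integral_comp_measurePreserving (hmp θ) hCi.1
    have j4 : ∫ p : E × E, ‖T (∇ h p.1)‖ ^ 2 ∂((stdGaussian E).prod (stdGaussian E)) = C :=
      integral_comp_measurePreserving measurePreserving_fst hCi.1
    have j5 : ∫ p : E × E, 2⁻¹ * (‖T (∇ h (cosPart T θ p.1 - sinPart T θ p.2))‖ ^ 2 +
        ‖T (∇ h p.1)‖ ^ 2) ∂((stdGaussian E).prod (stdGaussian E)) = C := by
      rw [integral_const_mul, integral_add j1 j2, j3, j4]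
      ring
    rw [← j5]
    refine integral_mono (integrable_inner_gradient_path hd hh T θ) ((j1.add j2).const_mul _)
      fun p => ?_
    have := real_inner_le_norm (T (∇ h (cosPart T θ p.1 - sinPart T θ p.2))) (T (∇ h p.1))
    dsimp only
    nlinarith [sq_nonneg (‖T (∇ h (cosPart T θ p.1 - sinPart T θ p.2))‖ - ‖T (∇ h p.1)‖)]
  let φ : ℝ → ℝ := fun θ => ∫ p : E × E, h p.1 * h (cosPart T θ p.1 + sinPart T θ p.2)
        ∂((stdGaussian E).prod (stdGaussian E))
  have hφ : ∀ θ, HasDerivAt (fun θ => φ θ - C * Real.cos θ) _ θ := fun θ =>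
    (hasDerivAt_integral_mul_comp_path hd hh T θ).sub ((Real.hasDerivAt_cos θ).const_mul C)
  -- The derivative is `sin θ` times the gap in `hle`; the term `C cos θ` is the antiderivative of
  -- the worst case.
  have hmono : MonotoneOn (fun θ => φ θ - C * Real.cos θ) (Set.Icc 0 (Real.pi / 2)) := by
    refine monotoneOn_of_deriv_nonneg (convex_Icc _ _)
      (fun θ _ => (hφ θ).continuousAt.continuousWithinAt)
      (fun θ _ => (hφ θ).differentiableAt.differentiableWithinAt) fun θ hθ => ?_
    rw [interior_Icc] at hθ
    have hs : 0 ≤ Real.sin θ :=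
      Real.sin_nonneg_of_nonneg_of_le_pi hθ.1.le (by linarith [hθ.2, Real.pi_pos])
    rw [(hφ θ).deriv, integral_mul_fderiv_path hd hh hT hTT]
    nlinarith [hle θ]
  have h0 : φ 0 = ∫ x, h x ^ 2 ∂(stdGaussian E) := by
    simp only [φ, cosPart_apply, sinPart_apply, Real.cos_zero, Real.sin_zero, one_smul, zero_smul,
      add_zero, sub_add_cancel, ← sq]
    exact integral_comp_measurePreserving (g := fun x => h x ^ 2) measurePreserving_fst
      (hh.continuous.pow 2).aestronglyMeasurable
  have h1 : φ (Real.pi / 2) = ∫ p : E × E, h p.1 * h (p.1 - T p.1 + T p.2)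
      ∂((stdGaussian E).prod (stdGaussian E)) := by
    simp [φ, cosPart_apply, sinPart_apply]
  have := hmono (Set.left_mem_Icc.mpr (by positivity)) (Set.right_mem_Icc.mpr (by positivity))
    (by positivity)
  simp only [h0, h1, Real.cos_zero, Real.cos_pi_div_two, mul_one, mul_zero, sub_zero] at this
  linarith

end Gaussian

/-! ### Conditional expectation as a Gaussian average -/

section Conditioning

set_option linter.unusedSectionVars false

variable {E : Type*} [NormedAddCommGroup E] [InnerProductSpace ℝ E] [FiniteDimensional ℝ E]
  [MeasurableSpace E] [BorelSpace E]

/-- The average of `h` over a Gaussian perturbation in the range of `T`. -/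
noncomputable def gaussianAverage (T : E →L[ℝ] E) (h : E → ℝ) (y : E) : ℝ :=
  ∫ z, h (y + T z) ∂(stdGaussian E)

lemma integrable_comp_add_clm {T : E →L[ℝ] E} {h : E → ℝ} {K : ℝ≥0} (hh : LipschitzWith K h)
    (y : E) : Integrable (fun z => h (y + T z)) (stdGaussian E) :=
  (memLp_lipschitzWith (hh.comp ((LipschitzWith.const y).add T.lipschitz))
    ENNReal.one_ne_top).integrable le_rfl

lemma lipschitzWith_gaussianAverage {T : E →L[ℝ] E} {h : E → ℝ} {K : ℝ≥0}
    (hh : LipschitzWith K h) : LipschitzWith K (gaussianAverage T h) := by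
  refine LipschitzWith.of_dist_le_mul fun x y => ?_
  rw [dist_eq_norm, gaussianAverage, gaussianAverage,
    ← integral_sub (integrable_comp_add_clm hh x) (integrable_comp_add_clm hh y)]
  refine (norm_integral_le_of_norm_le_const (C := K * dist x y) (ae_of_all _ fun z => ?_)).trans ?_
  · rw [← dist_eq_norm]
    simpa using hh.dist_le_mul (x + T z) (y + T z)
  · simp

/-- This is the end `θ = π/2` of the rotation: the `T`-component is replaced by an independent one.
-/
lemma measurePreserving_resample {T : E →L[ℝ] E} (hT : ∀ x y, ⟪T x, y⟫ = ⟪x, T y⟫)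
    (hTT : ∀ x, T (T x) = T x) :
    MeasurePreserving (fun p : E × E => p.1 - T p.1 + T p.2)
      ((stdGaussian E).prod (stdGaussian E)) (stdGaussian E) := by
  simpa [cosPart_apply, sinPart_apply] using
    measurePreserving_cosPart_add_sinPart hT hTT (Real.pi / 2)

/-- Functions that do not see the range of `T` integrate in the same way against `h` and against
its average over the range of `T`. -/
lemma integral_mul_gaussianAverage {T : E →L[ℝ] E} (hT : ∀ x y, ⟪T x, y⟫ = ⟪x, T y⟫)
    (hTT : ∀ x, T (T x) = T x) {h k : E → ℝ} (hhk : Integrable (fun x => k x * h x) (stdGaussian E))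
    (hk : ∀ x y, k (x - T x + T y) = k x) :
    ∫ z, k z * gaussianAverage T h (z - T z) ∂(stdGaussian E) =
      ∫ z, k z * h z ∂(stdGaussian E) := by
  have hmp := measurePreserving_resample hT hTT
  rw [← integral_comp_measurePreserving hmp hhk.1,
    integral_prod (fun p : E × E => k (p.1 - T p.1 + T p.2) * h (p.1 - T p.1 + T p.2))
      (hmp.integrable_comp_of_integrable hhk)]
  congr with z
  simp only [hk, gaussianAverage, integral_const_mul]

/-- The Gaussian Poincaré inequality for the deviation from the average over the range of an
orthogonal projection. -/
lemma integral_sq_sub_gaussianAverage_le {T : E →L[ℝ] E} (hT : ∀ x y, ⟪T x, y⟫ = ⟪x, T y⟫)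
    (hTT : ∀ x, T (T x) = T x) {h : E → ℝ} {K : ℝ≥0} (hd : ContDiff ℝ 1 h)
    (hh : LipschitzWith K h) :
    ∫ z, (h z - gaussianAverage T h (z - T z)) ^ 2 ∂(stdGaussian E) ≤
      ∫ z, ‖T (∇ h z)‖ ^ 2 ∂(stdGaussian E) := by
  obtain ⟨K', hg⟩ : ∃ K', LipschitzWith K' (fun z => gaussianAverage T h (z - T z)) :=
    ⟨_, (lipschitzWith_gaussianAverage hh).comp (LipschitzWith.id.sub T.lipschitz)⟩
  have hdec : LipschitzWith (K * _) (fun p : E × E => h (p.1 - T p.1 + T p.2)) :=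
    lipschitzWith_comp_clm hh ((ContinuousLinearMap.id ℝ E - T).comp (.fst ℝ E E) +
      T.comp (.snd ℝ E E))
  have i1 : Integrable (fun z => h z ^ 2) (stdGaussian E) := by
    simpa only [sq] using integrable_mul_lipschitzWith hh hh
  have i2 := integrable_mul_lipschitzWith (ν := stdGaussian E) hh hg
  have i3 := integrable_mul_lipschitzWith (ν := stdGaussian E) hg hg
  -- The average does not see the range of `T`, so it may serve as its own test function; hence
  -- `E[(h - g)²] = E[h²] - E[h g]` for the average `g`.
  have e1 : ∫ z, gaussianAverage T h (z - T z) * gaussianAverage T h (z - T z) ∂(stdGaussian E) =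
      ∫ z, h z * gaussianAverage T h (z - T z) ∂(stdGaussian E) := by
    rw [integral_mul_gaussianAverage (k := fun z => gaussianAverage T h (z - T z)) hT hTT
      (integrable_mul_lipschitzWith hg hh) fun x y => by simp [hTT]]
    simp only [mul_comm]
  have e2 : ∫ z, h z * gaussianAverage T h (z - T z) ∂(stdGaussian E) =
      ∫ p : E × E, h p.1 * h (p.1 - T p.1 + T p.2) ∂((stdGaussian E).prod (stdGaussian E)) := by
    have hfst : LipschitzWith (K * _) (fun p : E × E => h p.1) :=
      lipschitzWith_comp_clm hh (.fst ℝ E E)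
    rw [integral_prod _ (integrable_mul_lipschitzWith hfst hdec)]
    simp only [gaussianAverage, ← integral_const_mul]
  have e3 : ∫ z, (h z - gaussianAverage T h (z - T z)) ^ 2 ∂(stdGaussian E) =
      ∫ z, h z ^ 2 ∂(stdGaussian E) -
        ∫ z, h z * gaussianAverage T h (z - T z) ∂(stdGaussian E) := by
    have : ∀ z, (h z - gaussianAverage T h (z - T z)) ^ 2 = h z ^ 2 -
        2 * (h z * gaussianAverage T h (z - T z)) +
        gaussianAverage T h (z - T z) * gaussianAverage T h (z - T z) := fun z => by ring
    have i4 : Integrable (fun z => h z ^ 2 - 2 * (h z * gaussianAverage T h (z - T z)))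
        (stdGaussian E) := i1.sub (i2.const_mul 2)
    simp only [this]
    rw [integral_add i4 i3, integral_sub i1 (i2.const_mul 2),
      integral_const_mul, e1]
    ring
  rw [e3, e2]
  exact integral_sq_sub_integral_decoupled_le hd hh hT hTT

variable {m : E} {A P D T : E →L[ℝ] E} {μ : Measure E}

/-- The conditional expectation given a linear map of an affine image of a standard Gaussian
vector is an average over the orthogonal directions that this map does not see. -/
lemma gaussianAverage_ae_eq_condExp
    (hμ : MeasurePreserving (fun z => m + A z) (stdGaussian E) μ)
    (hT : ∀ x y, ⟪T x, y⟫ = ⟪x, T y⟫) (hTT : ∀ x, T (T x) = T x)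
    (hPAT : ∀ x, P (A (T x)) = 0) (hD : ∀ x, D (P (A x)) = x - T x) {f : E → ℝ} {K : ℝ≥0}
    (hf : LipschitzWith K f) :
    (fun x => gaussianAverage T (fun z => f (m + A z)) (D (P x - P m))) =ᵐ[μ]
      μ[f | MeasurableSpace.comap P inferInstance] := by
  have hle : MeasurableSpace.comap P inferInstance ≤ (inferInstance : MeasurableSpace E) :=
    P.measurable.comap_le
  have hprob : IsProbabilityMeasure μ := hμ.map_eq ▸ Measure.isProbabilityMeasure_map hμ.measurable.aemeasurable
  obtain ⟨K', hF⟩ : ∃ K', LipschitzWith K' (fun z => f (m + A z)) :=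
    ⟨_, hf.comp ((LipschitzWith.const m).add A.lipschitz)⟩
  have hg : Continuous (fun x => gaussianAverage T (fun z => f (m + A z)) (D (P x - P m))) :=
    (lipschitzWith_gaussianAverage hF).continuous.comp (by fun_prop)
  obtain ⟨K'', hgz⟩ :
      ∃ K'', LipschitzWith K'' (fun z => gaussianAverage T (fun z => f (m + A z)) (z - T z)) :=
    ⟨_, (lipschitzWith_gaussianAverage hF).comp (LipschitzWith.id.sub T.lipschitz)⟩
  have hcomp : ∀ z, gaussianAverage T (fun z => f (m + A z)) (D (P (m + A z) - P m)) =
      gaussianAverage T (fun z => f (m + A z)) (z - T z) := fun z => by simp [hD]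
  have hFi : Integrable (fun z => f (m + A z)) (stdGaussian E) :=
    (memLp_lipschitzWith hF ENNReal.one_ne_top).integrable le_rfl
  have hfi : Integrable f μ :=
    (hμ.integrable_comp hf.continuous.aestronglyMeasurable).mp hFi
  have hgi : Integrable (fun x => gaussianAverage T (fun z => f (m + A z)) (D (P x - P m))) μ := by
    refine (hμ.integrable_comp hg.aestronglyMeasurable).mp ?_
    simp only [Function.comp_def, hcomp]
    exact (memLp_lipschitzWith hgz ENNReal.one_ne_top).integrable le_rfl
  refine ae_eq_condExp_of_forall_setIntegral_eq hle hfi (fun s _ _ => hgi.integrableOn)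
    (fun s hs _ => ?_) ?_
  · obtain ⟨t, ht, rfl⟩ := hs
    have hs : MeasurableSet (P ⁻¹' t) := P.measurable ht
    rw [← integral_indicator hs, ← integral_indicator hs,
      ← integral_comp_measurePreserving hμ (hgi.1.indicator hs),
      ← integral_comp_measurePreserving hμ (hfi.1.indicator hs)]
    -- The indicator of the test event, pulled back to `z`, is blind to the range of `T` because `P
    -- A T = 0`.
    let k : E → ℝ := fun z => t.indicator 1 (P (m + A z))
    have hkm : Measurable k := (measurable_one.indicator ht).comp (by fun_prop)
    have hkF : Integrable (fun z => k z * f (m + A z)) (stdGaussian E) := by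
      refine hFi.bdd_mul (c := 1) hkm.aestronglyMeasurable (ae_of_all _ fun z => ?_)
      simp only [k, Set.indicator]
      split_ifs <;> simp
    have key := integral_mul_gaussianAverage (k := k) hT hTT hkF fun x y => by
      simp [k, hPAT]
    have hk1 : ∀ {z}, P (m + A z) ∈ t → k z = 1 := fun hz => Set.indicator_of_mem hz _
    have hk0 : ∀ {z}, P (m + A z) ∉ t → k z = 0 := fun hz => Set.indicator_of_notMem hz _
    convert key using 3 with z z <;> by_cases hz : P (m + A z) ∈ t
    · rw [Set.indicator_of_mem (by exact hz), hcomp, hk1 hz, one_mul]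
    · rw [Set.indicator_of_notMem (by exact hz), hk0 hz, zero_mul]
    · rw [Set.indicator_of_mem (by exact hz), hk1 hz, one_mul]
    · rw [Set.indicator_of_notMem (by exact hz), hk0 hz, zero_mul]
  · refine StronglyMeasurable.aestronglyMeasurable ?_
    have : Continuous (fun y => gaussianAverage T (fun z => f (m + A z)) (D (y - P m))) :=
      (lipschitzWith_gaussianAverage hF).continuous.comp (by fun_prop)
    exact this.stronglyMeasurable.comp_measurable (comap_measurable P)

/-- The Poincaré inequality for conditional expectations given a linear map of a Gaussian vector. -/
lemma integral_sq_sub_condExp_le {ι : Type*} [Fintype ι] (b : OrthonormalBasis ι ℝ E)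
    (hμ : MeasurePreserving (fun z => m + A z) (stdGaussian E) μ)
    (hT : ∀ x y, ⟪T x, y⟫ = ⟪x, T y⟫) (hTT : ∀ x, T (T x) = T x)
    (hPAT : ∀ x, P (A (T x)) = 0) (hD : ∀ x, D (P (A x)) = x - T x) {f : E → ℝ} {K : ℝ≥0}
    (hd : ContDiff ℝ 1 f) (hf : LipschitzWith K f) :
    Integrable (fun x => (f x - (μ[f | MeasurableSpace.comap P inferInstance]) x) ^ 2) μ ∧
    ∫ x, (f x - (μ[f | MeasurableSpace.comap P inferInstance]) x) ^ 2 ∂μ ≤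
      ∫ x, ∑ i, (fderiv ℝ f x (A (T (b i)))) ^ 2 ∂μ := by
  obtain ⟨K', hF⟩ : ∃ K', LipschitzWith K' (fun z => f (m + A z)) :=
    ⟨_, hf.comp ((LipschitzWith.const m).add A.lipschitz)⟩
  have hdF : ContDiff ℝ 1 (fun z => f (m + A z)) := hd.comp (by fun_prop)
  have hcd : Continuous (fderiv ℝ f) := hd.continuous_fderiv one_ne_zero
  have hG : LipschitzWith K' (gaussianAverage T fun z => f (m + A z)) :=
    lipschitzWith_gaussianAverage hF
  have hg : Continuous (fun x => gaussianAverage T (fun z => f (m + A z)) (D (P x - P m))) :=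
    hG.continuous.comp (by fun_prop)
  obtain ⟨K'', hgz⟩ :
      ∃ K'', LipschitzWith K'' (fun z => gaussianAverage T (fun z => f (m + A z)) (z - T z)) :=
    ⟨_, hG.comp (LipschitzWith.id.sub T.lipschitz)⟩
  have hae := gaussianAverage_ae_eq_condExp hμ hT hTT hPAT hD hf
  have hae' : (fun x => (f x - (μ[f | MeasurableSpace.comap P inferInstance]) x) ^ 2) =ᵐ[μ]
      fun x => (f x - gaussianAverage T (fun z => f (m + A z)) (D (P x - P m))) ^ 2 := by
    filter_upwards [hae] with x hx
    rw [hx]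
  have hm : AEStronglyMeasurable
      (fun x => (f x - gaussianAverage T (fun z => f (m + A z)) (D (P x - P m))) ^ 2) μ :=
    ((hf.continuous.sub hg).pow 2).aestronglyMeasurable
  have hcomp : ∀ z, gaussianAverage T (fun z => f (m + A z)) (D (P (m + A z) - P m)) =
      gaussianAverage T (fun z => f (m + A z)) (z - T z) := fun z => by simp [hD]
  constructor
  · refine Integrable.congr ((hμ.integrable_comp hm).mp ?_) hae'.symm
    simp only [Function.comp_def, hcomp]
    exact (memLp_lipschitzWith (p := 2) (hF.sub hgz) ENNReal.ofNat_ne_top).integrable_sq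
  · rw [integral_congr_ae hae', ← integral_comp_measurePreserving hμ hm,
      ← integral_comp_measurePreserving hμ (Continuous.aestronglyMeasurable (by fun_prop))]
    simp only [hcomp]
    refine (integral_sq_sub_gaussianAverage_le hT hTT hdF hF).trans_eq ?_
    congr with z
    -- Parseval for `T∇(f(m + A ·))`; the symmetry of `T` and the chain rule turn each coefficient
    -- into a derivative of `f` along `A T bᵢ`.
    rw [← b.sum_sq_inner_right]
    refine Finset.sum_congr rfl fun i _ => ?_
    have h1 : HasFDerivAt (fun z => m + A z) A z := A.hasFDerivAt.const_add m
    have h2 := (hd.differentiable one_ne_zero (m + A z)).hasFDerivAt.comp z h1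
    rw [← hT, real_inner_comm, ← InnerProductSpace.toDual_apply_apply (𝕜 := ℝ), toDual_gradient]
    change (fderiv ℝ (f ∘ fun z => m + A z) z (T (b i))) ^ 2 = _
    rw [h2.fderiv]
    rfl

end Conditioning

/-! ### Projectors, traces and generalized eigenvalues -/

section LinearAlgebra

variable {d : ℕ}

/-- The orthogonal projection onto the kernel of an idempotent matrix. -/
lemma exists_orthogonal_projection_ker (B : Matrix (Fin d) (Fin d) ℝ) (hB : B * B = B) :
    ∃ T : Matrix (Fin d) (Fin d) ℝ, Tᵀ = T ∧ T * T = T ∧ B * T = 0 ∧ T * (1 - B) = 1 - B := by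
  obtain ⟨e⟩ : Nonempty (Matrix (Fin d) (Fin d) ℝ ≃⋆ₐ[ℝ] (Eu d →L[ℝ] Eu d)) :=
    ⟨Matrix.toEuclideanCLM⟩
  let N : Submodule ℝ (Eu d) := LinearMap.ker (e B).toLinearMap
  have hN : ∀ x, e B (N.starProjection x) = 0 := fun x =>
    LinearMap.mem_ker.mp (N.starProjection_apply_mem x)
  have hN' : ∀ x, e (1 - B) x ∈ N := fun x => by
    have h : e B * e (1 - B) = 0 := by
      rw [← map_mul, mul_sub, mul_one, hB, sub_self, map_zero]
    exact LinearMap.mem_ker.mpr (DFunLike.congr_fun h x)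
  obtain ⟨T, hT⟩ : ∃ T, e T = N.starProjection := ⟨e.symm N.starProjection, e.apply_symm_apply _⟩
  have hsa : star T = T := by
    apply EquivLike.injective e
    rw [map_star, hT]
    exact isSelfAdjoint_starProjection N
  refine ⟨T, by simpa [star_eq_conjTranspose] using hsa, EquivLike.injective e ?_, EquivLike.injective e ?_,
    EquivLike.injective e ?_⟩
  · rw [map_mul, hT]
    exact N.isIdempotentElem_starProjection
  · rw [map_mul, hT, map_zero]
    exact ContinuousLinearMap.ext hN
  · rw [map_mul, hT]
    exact ContinuousLinearMap.ext fun x => Submodule.starProjection_eq_self_iff.mpr (hN' x)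

/-- Compressing a positive semidefinite matrix by an orthogonal projection decreases its trace. -/
lemma trace_compression_le {M T : Matrix (Fin d) (Fin d) ℝ} (hM : M.PosSemidef) (hT : Tᵀ = T)
    (hTT : T * T = T) : (T * M * T).trace ≤ M.trace := by
  have h1 : (T * M * T).trace = (M * T).trace := by
    rw [Matrix.mul_assoc, Matrix.trace_mul_comm, Matrix.mul_assoc, hTT]
  -- The loss of trace is the trace of the complementary compression, hence nonnegative.
  have h2 : ((1 - T)ᵀ * M * (1 - T)).trace = M.trace - (M * T).trace := by
    have h3 : (1 - T) * (1 - T)ᵀ = 1 - T := by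
      rw [transpose_sub, transpose_one, hT]
      simp [mul_sub, sub_mul, hTT]
    rw [Matrix.mul_assoc, Matrix.trace_mul_comm, Matrix.mul_assoc, h3, mul_sub, mul_one,
      trace_sub]
  have h4 : 0 ≤ ((1 - T)ᵀ * M * (1 - T)).trace := by
    have := (hM.conjTranspose_mul_mul_same (1 - T)).trace_nonneg
    simpa using this
  rw [h1]
  linarith

lemma poincareBound_eq_trace {A S H P : Matrix (Fin d) (Fin d) ℝ} (hA : Aᵀ = A) (hAA : A * A = S) :
    poincareBound S H P = (((1 - P) * A)ᵀ * H * ((1 - P) * A)).trace := by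
  rw [poincareBound, ← hAA, transpose_mul, transpose_sub, transpose_one, hA]
  simp only [Matrix.mul_assoc]
  rw [Matrix.trace_mul_comm]
  simp only [Matrix.mul_assoc]

/-- The eigenvectors become the columns of `V`; orthonormality makes `Vᵀ S⁻¹` the inverse of `V`. -/
lemma IsGenEigenvalues.exists_matrix {H S : Matrix (Fin d) (Fin d) ℝ} {lam : Fin d → ℝ}
    (h : IsGenEigenvalues H S⁻¹ lam) : ∃ V : Matrix (Fin d) (Fin d) ℝ,
      Vᵀ * S⁻¹ * V = 1 ∧ H * V = S⁻¹ * V * diagonal lam := by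
  obtain ⟨-, v, hv, hHv⟩ := h
  refine ⟨(Matrix.of v)ᵀ, ?_, ?_⟩
  · ext i j
    have : ((Matrix.of v)ᵀᵀ * S⁻¹ * (Matrix.of v)ᵀ) i j = v i ⬝ᵥ (S⁻¹ *ᵥ v j) := by
      rw [Matrix.mul_assoc, Matrix.mul_apply']
      rfl
    rw [this, hv, Matrix.one_apply]
  · ext i j
    rw [Matrix.mul_diagonal, mul_comm]
    exact congrFun (hHv j) i

/-- The optimal value of the bound over rank-`r` projectors is at most the tail sum of the
generalized eigenvalues. -/
lemma exists_isProjector_poincareBound_eq {H S : Matrix (Fin d) (Fin d) ℝ} (hS : S.PosDef)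
    {lam : Fin d → ℝ} (h : IsGenEigenvalues H S⁻¹ lam) {r : ℕ} (hr : r ≤ d) :
    ∃ Q, IsProjector r Q ∧ poincareBound S H Q = ∑ i with r ≤ i.val, lam i := by
  obtain ⟨V, hV, hHV⟩ := h.exists_matrix
  have hSS : S * S⁻¹ = 1 := Matrix.mul_nonsing_inv _ ((Matrix.isUnit_iff_isUnit_det _).mp hS.isUnit)
  have hSt : S⁻¹ᵀ = S⁻¹ := by simpa using hS.isHermitian.inv.eq
  have hV' : V * (Vᵀ * S⁻¹) = 1 := mul_eq_one_comm.mp hV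
  -- The witness is `V D V⁻¹`, the projector onto the first `r` eigenvectors along the others; `r ≤
  -- d` makes its rank exactly `r`.
  let D : Matrix (Fin d) (Fin d) ℝ := diagonal fun i => if i.val < r then 1 else 0
  let D' : Matrix (Fin d) (Fin d) ℝ := diagonal fun i => if r ≤ i.val then 1 else 0
  have hDD : D * D = D := by simp [D]
  have hD' : 1 - D = D' := by
    rw [← diagonal_one, diagonal_sub]
    congr 1
    ext i
    by_cases hi : i.val < r <;> simp [hi]
  have hQ : 1 - V * D * (Vᵀ * S⁻¹) = V * D' * (Vᵀ * S⁻¹) := by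
    rw [← hD', mul_sub, mul_one, sub_mul, hV']
  have hu : IsUnit V := IsUnit.of_mul_eq_one _ hV'
  have hu' : IsUnit (Vᵀ * S⁻¹) := IsUnit.of_mul_eq_one _ hV
  refine ⟨V * D * (Vᵀ * S⁻¹), ⟨?_, ?_⟩, ?_⟩
  · calc V * D * (Vᵀ * S⁻¹) * (V * D * (Vᵀ * S⁻¹))
        = V * D * (Vᵀ * S⁻¹ * V) * D * (Vᵀ * S⁻¹) := by simp only [Matrix.mul_assoc]
      _ = V * D * (Vᵀ * S⁻¹) := by rw [hV, mul_one, Matrix.mul_assoc V D D, hDD]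
  · rw [Matrix.rank_mul_eq_left_of_isUnit_det _ _ ((Matrix.isUnit_iff_isUnit_det _).mp hu'),
      Matrix.rank_mul_eq_right_of_isUnit_det _ _ ((Matrix.isUnit_iff_isUnit_det _).mp hu),
      rank_diagonal]
    simp [Fintype.card_subtype, Fin.card_filter_val_lt, hr]
  · rw [poincareBound, ← transpose_one, ← transpose_sub, transpose_one, hQ]
    have e1 : (V * D' * (Vᵀ * S⁻¹))ᵀ = S⁻¹ * (V * D' * Vᵀ) := by
      simp only [transpose_mul, transpose_transpose, hSt, D', diagonal_transpose, Matrix.mul_assoc]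
    rw [e1, ← Matrix.mul_assoc S, hSS, one_mul]
    calc (V * D' * Vᵀ * H * (V * D' * (Vᵀ * S⁻¹))).trace
        = (V * D' * Vᵀ * (H * V) * D' * (Vᵀ * S⁻¹)).trace := by simp only [Matrix.mul_assoc]
      _ = (V * D' * (Vᵀ * S⁻¹ * V) * diagonal lam * D' * (Vᵀ * S⁻¹)).trace := by
          rw [hHV]; simp only [Matrix.mul_assoc]
      _ = (V * (D' * diagonal lam * D' * (Vᵀ * S⁻¹))).trace := by
          rw [hV, mul_one]; simp only [Matrix.mul_assoc]
      _ = (D' * diagonal lam * D').trace := by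
          rw [Matrix.trace_mul_comm, Matrix.mul_assoc, hV, mul_one]
      _ = ∑ i with r ≤ i.val, lam i := by
          simp only [D', diagonal_mul_diagonal, trace_diagonal, Finset.sum_filter]
          refine Finset.sum_congr rfl fun i _ => ?_
          split_ifs <;> simp

/-- Comparison of generalized eigenvalues (a Courant-Fischer argument): if `H ≤ C` then the
`j`-th eigenvalue of `(H, S⁻¹)` is at most `C` times the `j`-th eigenvalue of `S`. -/
lemma genEigenvalue_le {H S U : Matrix (Fin d) (Fin d) ℝ} {lam s : Fin d → ℝ}
    (h : IsGenEigenvalues H S⁻¹ lam) (hU : U * Uᵀ = 1) (hSU : S = U * diagonal s * Uᵀ)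
    (hdet : IsUnit S.det) (hs : Antitone s) (hpos : ∀ i, 0 < s i) {C : ℝ} (hC : 0 ≤ C)
    (hH : ∀ x : Fin d → ℝ, x ⬝ᵥ (H *ᵥ x) ≤ C * (x ⬝ᵥ x)) (j : Fin d) : lam j ≤ C * s j := by
  obtain ⟨V, hV, hHV⟩ := h.exists_matrix
  have hU' : Uᵀ * U = 1 := mul_eq_one_comm.mp hU
  -- Dimension count by a determinant: rows above `j` force `V c` to be orthogonal to the first `j`
  -- eigenvectors of `S`, rows below kill the coordinates of `c` after `j`, and row `j` is zero. A
  -- nonzero solution `c` must exist.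
  let N : Matrix (Fin d) (Fin d) ℝ := Matrix.of fun i =>
    if i < j then (Uᵀ * V) i else if j < i then Pi.single i 1 else 0
  have hN : N.det = 0 := det_eq_zero_of_row_eq_zero j fun k => by simp [N]
  obtain ⟨c, hc0, hc⟩ := Matrix.exists_mulVec_eq_zero_iff.mpr hN
  have hc1 : ∀ i, i < j → ((Uᵀ * V) *ᵥ c) i = 0 := fun i hi => by
    have := congrFun hc i
    simpa [Matrix.mulVec, N, hi] using this
  have hc2 : ∀ i, j < i → c i = 0 := fun i hi => by
    have := congrFun hc i
    simpa [Matrix.mulVec, N, hi, hi.not_gt] using this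
  set x := V *ᵥ c with hx
  set z := S⁻¹ *ᵥ x with hz
  set t := Uᵀ *ᵥ z with ht
  have hxz : x = S *ᵥ z := by
    rw [hz, mulVec_mulVec, Matrix.mul_nonsing_inv _ hdet, one_mulVec]
  have hUx : Uᵀ *ᵥ x = fun i => s i * t i := by
    have hUS : Uᵀ * S = diagonal s * Uᵀ := by
      rw [hSU, ← Matrix.mul_assoc, ← Matrix.mul_assoc, hU', one_mul]
    calc Uᵀ *ᵥ x = Uᵀ *ᵥ (S *ᵥ z) := by rw [← hxz]
      _ = diagonal s *ᵥ t := by rw [mulVec_mulVec, hUS, ← mulVec_mulVec]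
      _ = _ := funext fun i => mulVec_diagonal s t i
  have ht0 : ∀ i, i < j → t i = 0 := fun i hi => by
    have h1 := hc1 i hi
    rw [← mulVec_mulVec, ← hx, hUx] at h1
    exact (mul_eq_zero.mp h1).resolve_left (hpos i).ne'
  have dotU : ∀ a b : Fin d → ℝ, (Uᵀ *ᵥ a) ⬝ᵥ (Uᵀ *ᵥ b) = a ⬝ᵥ b := fun a b => by
    rw [mulVec_transpose U a, ← dotProduct_mulVec, mulVec_mulVec, hU, one_mulVec]
  have dotV : ∀ a b : Fin d → ℝ, (V *ᵥ a) ⬝ᵥ b = a ⬝ᵥ (Vᵀ *ᵥ b) := fun a b => by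
    rw [dotProduct_mulVec, vecMul_transpose]
  -- With `t = Uᵀ S⁻¹ x`, both `‖x‖²` and `xᵀ S⁻¹ x = ‖c‖²` are weighted sums of the `tᵢ²`, with
  -- weights `sᵢ²` and `sᵢ`. The support of `c` gives `λⱼ` as a lower bound for one Rayleigh
  -- quotient, that of `t` gives `sⱼ` as an upper bound for the other.
  have exx : x ⬝ᵥ x = ∑ i, s i * (s i * t i ^ 2) := by
    rw [← dotU, hUx]
    exact Finset.sum_congr rfl fun i _ => by ring
  have ecc : ∑ i, c i ^ 2 = ∑ i, s i * t i ^ 2 := by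
    have h1 : x ⬝ᵥ z = c ⬝ᵥ c := by
      rw [hx, dotV, hz, hx, mulVec_mulVec, mulVec_mulVec, hV, one_mulVec]
    rw [← dotU, hUx] at h1
    calc ∑ i, c i ^ 2 = c ⬝ᵥ c := Finset.sum_congr rfl fun i _ => sq _
      _ = _ := h1.symm
      _ = _ := Finset.sum_congr rfl fun i _ => by rw [← ht]; ring
  have eH : x ⬝ᵥ (H *ᵥ x) = ∑ i, lam i * c i ^ 2 := by
    rw [hx, dotV, mulVec_mulVec, mulVec_mulVec, Matrix.mul_assoc, hHV, ← Matrix.mul_assoc,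
      ← Matrix.mul_assoc, hV, one_mul]
    exact Finset.sum_congr rfl fun i _ => by rw [mulVec_diagonal]; ring
  have k1 : lam j * ∑ i, c i ^ 2 ≤ ∑ i, lam i * c i ^ 2 := by
    rw [Finset.mul_sum]
    refine Finset.sum_le_sum fun i _ => ?_
    rcases le_or_gt i j with hi | hi
    · exact mul_le_mul_of_nonneg_right (h.1 hi) (sq_nonneg _)
    · simp [hc2 i hi]
  have k2 : ∑ i, s i * (s i * t i ^ 2) ≤ s j * ∑ i, s i * t i ^ 2 := by
    rw [Finset.mul_sum]
    refine Finset.sum_le_sum fun i _ => ?_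
    rcases lt_or_ge i j with hi | hi
    · simp [ht0 i hi]
    · exact mul_le_mul_of_nonneg_right (hs hi) (mul_nonneg (hpos i).le (sq_nonneg _))
  have kpos : 0 < ∑ i, c i ^ 2 := by
    obtain ⟨i, hi⟩ := Function.ne_iff.mp hc0
    exact Finset.sum_pos' (fun _ _ => sq_nonneg _) ⟨i, Finset.mem_univ _, by
      have : c i ≠ 0 := hi
      positivity⟩
  refine le_of_mul_le_mul_right ?_ kpos
  calc lam j * ∑ i, c i ^ 2 ≤ x ⬝ᵥ (H *ᵥ x) := eH ▸ k1
    _ ≤ C * (x ⬝ᵥ x) := hH x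
    _ ≤ C * (s j * ∑ i, s i * t i ^ 2) := by rw [exx]; gcongr
    _ = C * s j * ∑ i, c i ^ 2 := by rw [ecc, mul_assoc]

/-- An orthogonal diagonalization with the eigenvalues in decreasing order. -/
lemma exists_orthogonal_diagonalization {S : Matrix (Fin d) (Fin d) ℝ} (hS : S.IsHermitian) :
    ∃ U : Matrix (Fin d) (Fin d) ℝ, U * Uᵀ = 1 ∧ S = U * diagonal (fun i =>
      hS.eigenvalues₀ (Fin.cast (Fintype.card_fin d).symm i)) * Uᵀ := by
  -- `eigenvalues` is the sorted list `eigenvalues₀` read through an unspecified bijection; `e`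
  -- undoes it, and the eigenvector columns are permuted accordingly.
  let e : Fin d ≃ Fin d := (finCongr (Fintype.card_fin d).symm).trans
    (Fintype.equivOfCardEq (Fintype.card_fin (Fintype.card (Fin d))))
  let W : Matrix (Fin d) (Fin d) ℝ := hS.eigenvectorUnitary
  have hW : W * Wᵀ = 1 := by
    simpa [star_eq_conjTranspose] using Unitary.coe_mul_star_self hS.eigenvectorUnitary
  have hspec : S = W * diagonal hS.eigenvalues * Wᵀ := by
    have := hS.spectral_theorem
    simpa [Unitary.conjStarAlgAut_apply, star_eq_conjTranspose, Function.comp_def] using this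
  have hlam : (fun i => hS.eigenvalues₀ (Fin.cast (Fintype.card_fin d).symm i)) =
      hS.eigenvalues ∘ e := by
    ext i
    simp [Matrix.IsHermitian.eigenvalues, e]
  refine ⟨W.submatrix id e, ?_, ?_⟩
  · rw [transpose_submatrix, submatrix_mul_equiv, hW, submatrix_id_id]
  · rw [hlam, ← submatrix_diagonal_equiv, submatrix_mul_equiv, transpose_submatrix,
      submatrix_mul_equiv, ← hspec]
    simp

end LinearAlgebra

/-! ### From the scalar Poincaré inequality to the trace bound -/

section Bound

variable {d n : ℕ}

/-- The continuous linear map of `ℝᵏ` given by a square matrix. -/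
noncomputable abbrev mulCLM {k : ℕ} (M : Matrix (Fin k) (Fin k) ℝ) : Eu k →L[ℝ] Eu k :=
  Matrix.toEuclideanCLM (𝕜 := ℝ) M

lemma mulCLM_mulCLM {k : ℕ} (M N : Matrix (Fin k) (Fin k) ℝ) (x : Eu k) :
    mulCLM M (mulCLM N x) = mulCLM (M * N) x := by
  rw [mulCLM, mulCLM, mulCLM, map_mul]
  rfl

lemma norm_sq_eq_dotProduct {k : ℕ} (v : Eu k) : ‖v‖ ^ 2 = v.ofLp ⬝ᵥ v.ofLp := by
  rw [EuclideanSpace.real_norm_sq_eq]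
  exact Finset.sum_congr rfl fun i _ => sq _

lemma vNorm_eq_norm {R B : Matrix (Fin n) (Fin n) ℝ} (hB : R = Bᵀ * B) (v : Eu n) :
    vNorm R v = ‖mulCLM B v‖ := by
  have h : v.ofLp ⬝ᵥ (R *ᵥ v.ofLp) = ‖mulCLM B v‖ ^ 2 := by
    rw [norm_sq_eq_dotProduct, ofLp_toEuclideanCLM, hB, ← mulVec_mulVec, dotProduct_mulVec,
      vecMul_transpose]
  rw [vNorm, h, Real.sqrt_sq (norm_nonneg _)]

variable {f : Eu d → Eu n}

lemma fderiv_mulCLM_comp (hf : ContDiff ℝ 1 f) (B : Matrix (Fin n) (Fin n) ℝ) (x v : Eu d) :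
    fderiv ℝ (fun x => mulCLM B (f x)) x v = mulCLM B (fderiv ℝ f x v) := by
  have h := (mulCLM B).hasFDerivAt.comp x (hf.differentiable one_ne_zero x).hasFDerivAt
  change fderiv ℝ (mulCLM B ∘ f) x v = _
  rw [h.fderiv]
  rfl

/-- Absorbing `B` into the map makes the integrand of `H` the Gram matrix of the partial derivatives
of `B f`. -/
lemma jacobian_gram_apply {R B : Matrix (Fin n) (Fin n) ℝ} (hB : R = Bᵀ * B)
    (hf : ContDiff ℝ 1 f) (x : Eu d) (i j : Fin d) :
    ((jacobian f x)ᵀ * R * jacobian f x) i j =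
      ⟪fderiv ℝ (fun x => mulCLM B (f x)) x (EuclideanSpace.single i 1),
        fderiv ℝ (fun x => mulCLM B (f x)) x (EuclideanSpace.single j 1)⟫ := by
  have h : ∀ i k, (B * jacobian f x) k i =
      (fderiv ℝ (fun x => mulCLM B (f x)) x (EuclideanSpace.single i 1)) k := fun i k => by
    rw [fderiv_mulCLM_comp hf, ofLp_toEuclideanCLM]
    rfl
  have h2 : (jacobian f x)ᵀ * R * jacobian f x = (B * jacobian f x)ᵀ * (B * jacobian f x) := by
    rw [hB, transpose_mul]
    simp only [Matrix.mul_assoc]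
  rw [h2, Matrix.mul_apply, PiLp.inner_apply]
  refine Finset.sum_congr rfl fun k _ => ?_
  rw [transpose_apply, h, h]
  simp [mul_comm]

lemma norm_fderiv_apply_le {G : Eu d → Eu n} {K : ℝ≥0} (hG : LipschitzWith K G) (x v : Eu d) :
    ‖fderiv ℝ G x v‖ ≤ K * ‖v‖ :=
  (fderiv ℝ G x).le_of_opNorm_le (norm_fderiv_le_of_lipschitz ℝ hG) v

lemma integrable_inner_fderiv {μ : Measure (Eu d)} [IsFiniteMeasure μ] {G : Eu d → Eu n} {K : ℝ≥0}
    (hd : ContDiff ℝ 1 G) (hG : LipschitzWith K G) (v w : Eu d) :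
    Integrable (fun x => ⟪fderiv ℝ G x v, fderiv ℝ G x w⟫) μ := by
  have hcd : Continuous (fderiv ℝ G) := hd.continuous_fderiv one_ne_zero
  refine Integrable.of_bound (Continuous.aestronglyMeasurable (by fun_prop))
    (K * ‖v‖ * (K * ‖w‖)) (ae_of_all _ fun x => ?_)
  refine (norm_inner_le_norm _ _).trans ?_
  gcongr <;> exact norm_fderiv_apply_le hG _ _

/-- The quadratic form of the gradient matrix is the mean square directional derivative. -/
lemma dotProduct_gradMatrix_mulVec {R B : Matrix (Fin n) (Fin n) ℝ} (hB : R = Bᵀ * B)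
    {μ : Measure (Eu d)} [IsFiniteMeasure μ] (hf : ContDiff ℝ 1 f) {K : ℝ≥0}
    (hG : LipschitzWith K fun x => mulCLM B (f x)) (v : Eu d) :
    v.ofLp ⬝ᵥ (gradMatrix R μ f *ᵥ v.ofLp) =
      ∫ x, ‖fderiv ℝ (fun x => mulCLM B (f x)) x v‖ ^ 2 ∂μ := by
  have hd : ContDiff ℝ 1 fun x => mulCLM B (f x) := (mulCLM B).contDiff.comp hf
  have hv : v = ∑ i, v.ofLp i • EuclideanSpace.single i (1 : ℝ) := by
    simpa using ((EuclideanSpace.basisFun (Fin d) ℝ).sum_repr v).symm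
  have hexp : ∀ x, ‖fderiv ℝ (fun x => mulCLM B (f x)) x v‖ ^ 2 =
      ∑ i, ∑ j, v.ofLp i * (⟪fderiv ℝ (fun x => mulCLM B (f x)) x (EuclideanSpace.single i 1),
        fderiv ℝ (fun x => mulCLM B (f x)) x (EuclideanSpace.single j 1)⟫ * v.ofLp j) :=
    fun x => by
      conv_lhs => rw [hv]
      rw [← real_inner_self_eq_norm_sq, map_sum, sum_inner]
      refine Finset.sum_congr rfl fun i _ => ?_
      rw [inner_sum]
      refine Finset.sum_congr rfl fun j _ => ?_
      rw [map_smul, map_smul, real_inner_smul_left, real_inner_smul_right]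
      ring
  simp only [hexp]
  rw [integral_finsetSum _ fun i _ => integrable_finsetSum _ fun j _ =>
    ((integrable_inner_fderiv hd hG _ _).mul_const _).const_mul _, dotProduct]
  refine Finset.sum_congr rfl fun i _ => ?_
  rw [integral_finsetSum _ fun j _ => ((integrable_inner_fderiv hd hG _ _).mul_const _).const_mul _,
    mulVec, dotProduct, Finset.mul_sum]
  refine Finset.sum_congr rfl fun j _ => ?_
  rw [integral_const_mul, integral_mul_const, gradMatrix, of_apply]
  simp only [jacobian_gram_apply hB hf]

lemma gradMatrix_posSemidef {R B : Matrix (Fin n) (Fin n) ℝ} (hR : R.PosDef) (hB : R = Bᵀ * B)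
    {μ : Measure (Eu d)} [IsFiniteMeasure μ] (hf : ContDiff ℝ 1 f) {K : ℝ≥0}
    (hG : LipschitzWith K fun x => mulCLM B (f x)) : (gradMatrix R μ f).PosSemidef := by
  refine Matrix.PosSemidef.of_dotProduct_mulVec_nonneg (gradMatrix_isHermitian hR μ f) fun v => ?_
  have := dotProduct_gradMatrix_mulVec hB (μ := μ) hf hG (WithLp.toLp 2 v)
  rw [star_trivial]
  rw [WithLp.ofLp_toLp] at this
  rw [this]
  positivity

/-- The mean square error of the conditional expectation given a projector is at most the Poincaré
bound of the projector. -/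
lemma integral_vNorm_sq_sub_condExp_le {m : Eu d} {S P : Matrix (Fin d) (Fin d) ℝ}
    (hS : S.PosDef) {R B : Matrix (Fin n) (Fin n) ℝ} (hR : R.PosDef) (hB : R = Bᵀ * B)
    (hP : P * P = P) (hf : ContDiff ℝ 1 f) {K : ℝ≥0}
    (hG : LipschitzWith K fun x => mulCLM B (f x)) (hfi : Integrable f (multivariateGaussian m S)) :
    Integrable (fun x => vNorm R (f x - (multivariateGaussian m S)[f | sigmaAlg P] x) ^ 2)
      (multivariateGaussian m S) ∧
    ∫ x, vNorm R (f x - (multivariateGaussian m S)[f | sigmaAlg P] x) ^ 2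
        ∂(multivariateGaussian m S) ≤
      poincareBound S (gradMatrix R (multivariateGaussian m S) f) P := by
  set μ := multivariateGaussian m S
  set A : Matrix (Fin d) (Fin d) ℝ := CFC.sqrt S
  have hAA : A * A = S := CFC.sqrt_mul_sqrt_self S hS.posSemidef.nonneg
  have hAt : Aᵀ = A := by
    have := (CFC.sqrt_nonneg S).isSelfAdjoint.star_eq
    simpa [star_eq_conjTranspose] using this
  have hAu : IsUnit A.det := by
    have h := (Matrix.isUnit_iff_isUnit_det _).mp hS.isUnit
    rw [← hAA, Matrix.det_mul] at h
    exact isUnit_of_mul_isUnit_right h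
  have hAi : A * A⁻¹ = 1 := Matrix.mul_nonsing_inv _ hAu
  obtain ⟨T, hTt, hTT, hBT, hTB⟩ := exists_orthogonal_projection_ker (A⁻¹ * P * A) (by
    calc A⁻¹ * P * A * (A⁻¹ * P * A) = A⁻¹ * P * (A * A⁻¹) * P * A := by
          simp only [Matrix.mul_assoc]
      _ = A⁻¹ * P * A := by rw [hAi, mul_one, Matrix.mul_assoc A⁻¹ P P, hP])
  have hPAT : P * A * T = 0 := by
    calc P * A * T = A * (A⁻¹ * P * A * T) := by
          simp only [← Matrix.mul_assoc]
          rw [hAi, one_mul]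
      _ = 0 := by rw [hBT, mul_zero]
  have hmp : MeasurePreserving (fun z => m + mulCLM A z) (stdGaussian (Eu d)) μ :=
    ⟨by fun_prop, rfl⟩
  have hd : ContDiff ℝ 1 fun x => mulCLM B (f x) := (mulCLM B).contDiff.comp hf
  -- These functionals are the coordinates of `B v`. They commute with conditional expectation, and
  -- their squares add up to the squared `V`-norm.
  let pr : Fin n → Eu n →L[ℝ] ℝ := fun k => (EuclideanSpace.proj k).comp (mulCLM B)
  have hprG : ∀ k v, pr k v = mulCLM B v k := fun k v => rfl
  have hFlip : ∀ k, LipschitzWith K (pr k ∘ f) := fun k =>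
    LipschitzWith.of_dist_le_mul fun x y => by
      refine le_trans ?_ (hG.dist_le_mul x y)
      rw [dist_eq_norm, dist_eq_norm]
      exact PiLp.norm_apply_le (mulCLM B (f x) - mulCLM B (f y)) k
  have hFd : ∀ k, ContDiff ℝ 1 (pr k ∘ f) := fun k => (pr k).contDiff.comp hf
  have hFder : ∀ k x v, fderiv ℝ (pr k ∘ f) x v = fderiv ℝ (fun x => mulCLM B (f x)) x v k :=
    fun k x v => by
      rw [fderiv_mulCLM_comp hf,
        ((pr k).hasFDerivAt.comp x (hf.differentiable one_ne_zero x).hasFDerivAt).fderiv]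
      rfl
  have key := fun k => integral_sq_sub_condExp_le (EuclideanSpace.basisFun (Fin d) ℝ)
    (A := mulCLM A) (P := mulCLM P) (T := mulCLM T) (D := mulCLM ((1 - T) * A⁻¹)) hmp
    (fun x y => by
      rw [real_inner_comm, inner_toEuclideanCLM, inner_toEuclideanCLM, dotProduct_comm,
        ← vecMul_transpose, hTt, dotProduct_mulVec])
    (fun x => by rw [mulCLM_mulCLM, hTT])
    (fun x => by rw [mulCLM_mulCLM, mulCLM_mulCLM, hPAT, mulCLM, map_zero]; rfl)
    -- Since `T` fixes the range of `1 - A⁻¹PA`, one has `(1 - T)A⁻¹PA = 1 - T`: the map `D`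
    -- recovers `z - T z` from `P A z`.
    (fun x => by
      have h1 : (1 - T) * A⁻¹ * P * A = 1 - T := by
        calc (1 - T) * A⁻¹ * P * A = (1 - T) * (A⁻¹ * P * A) := by simp only [Matrix.mul_assoc]
          _ = 1 - T + (T * (1 - A⁻¹ * P * A) - (1 - A⁻¹ * P * A)) := by noncomm_ring
          _ = 1 - T := by rw [hTB, sub_self, add_zero]
      rw [mulCLM_mulCLM, mulCLM_mulCLM, h1, mulCLM, map_sub, map_one]
      rfl) (hFd k) (hFlip k)
  have hce : ∀ᵐ x ∂μ, ∀ k, pr k (μ[f | sigmaAlg P] x) = μ[pr k ∘ f | sigmaAlg P] x :=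
    ae_all_iff.mpr fun k => (pr k).comp_condExp_comm hfi
  have hae : (fun x => vNorm R (f x - μ[f | sigmaAlg P] x) ^ 2) =ᵐ[μ]
      fun x => ∑ k, ((pr k ∘ f) x - μ[pr k ∘ f | sigmaAlg P] x) ^ 2 := by
    filter_upwards [hce] with x hx
    rw [vNorm_eq_norm hB, EuclideanSpace.real_norm_sq_eq]
    refine Finset.sum_congr rfl fun k _ => ?_
    rw [← hprG, map_sub, hx, Function.comp_apply]
  refine ⟨(integrable_finsetSum _ fun k _ => (key k).1).congr hae.symm, ?_⟩
  have hH := gradMatrix_posSemidef hR hB (μ := μ) hf hG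
  set H := gradMatrix R μ f with hHdef
  have hsq : ∀ v, Integrable (fun x => ‖fderiv ℝ (fun x => mulCLM B (f x)) x v‖ ^ 2) μ :=
    fun v => by simpa using integrable_inner_fderiv (μ := μ) hd hG v v
  have hcoord : ∀ k v, Integrable (fun x => fderiv ℝ (pr k ∘ f) x v ^ 2) μ := fun k v => by
    have hcd : Continuous (fderiv ℝ (pr k ∘ f)) := (hFd k).continuous_fderiv one_ne_zero
    refine (hsq v).mono' (Continuous.aestronglyMeasurable (by fun_prop)) (ae_of_all _ fun x => ?_)
    rw [norm_pow, hFder]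
    gcongr
    exact PiLp.norm_apply_le _ k
  calc ∫ x, vNorm R (f x - μ[f | sigmaAlg P] x) ^ 2 ∂μ
      = ∑ k, ∫ x, ((pr k ∘ f) x - μ[pr k ∘ f | sigmaAlg P] x) ^ 2 ∂μ := by
        rw [integral_congr_ae hae, integral_finsetSum _ fun k _ => (key k).1]
    _ ≤ ∑ k, ∫ x, ∑ i, (fderiv ℝ (pr k ∘ f) x
          (mulCLM A (mulCLM T (EuclideanSpace.basisFun (Fin d) ℝ i)))) ^ 2 ∂μ :=
        Finset.sum_le_sum fun k _ => (key k).2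
    _ = ∑ i, ∫ x, ‖fderiv ℝ (fun x => mulCLM B (f x)) x
          (mulCLM A (mulCLM T (EuclideanSpace.basisFun (Fin d) ℝ i)))‖ ^ 2 ∂μ := by
        simp only [EuclideanSpace.real_norm_sq_eq, ← hFder]
        rw [← integral_finsetSum _ fun k _ => integrable_finsetSum _ fun i _ => hcoord k _]
        simp only [integral_finsetSum _ fun k _ => hcoord k _]
        rw [integral_finsetSum _ fun k _ => integrable_finsetSum _ fun i _ => hcoord k _,
          Finset.sum_comm]
        simp only [integral_finsetSum _ fun i _ => hcoord _ _]
    _ = ((A * T)ᵀ * H * (A * T)).trace := by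
        refine Finset.sum_congr rfl fun i _ => ?_
        rw [← dotProduct_gradMatrix_mulVec hB hf hG, diag_apply, Matrix.mul_assoc,
          Matrix.mul_apply', mulCLM_mulCLM, ofLp_toEuclideanCLM]
        congr 1 <;> ext j <;> simp [Matrix.mul_apply, Matrix.mulVec, dotProduct, hHdef]
    -- As `P A T = 0`, inserting `1 - P` costs nothing and exposes a compression by `T`.
    _ = (T * (((1 - P) * A)ᵀ * H * ((1 - P) * A)) * T).trace := by
        have h1 : (1 - P) * A * T = A * T := by
          rw [sub_mul, one_mul, sub_mul, hPAT, sub_zero]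
        rw [← h1, transpose_mul _ T, hTt]
        simp only [Matrix.mul_assoc]
    _ ≤ (((1 - P) * A)ᵀ * H * ((1 - P) * A)).trace := by
        refine trace_compression_le ?_ hTt hTT
        rw [← conjTranspose_eq_transpose_of_trivial]
        exact hH.conjTranspose_mul_mul_same ((1 - P) * A)
    _ = poincareBound S H P := (poincareBound_eq_trace hAt hAA).symm

end Bound

/-! ### Assembly of the two inequalities -/

lemma exists_isUnit_transpose_mul_self {n : ℕ} {R : Matrix (Fin n) (Fin n) ℝ} (hR : R.PosDef) :
    ∃ B : Matrix (Fin n) (Fin n) ℝ, IsUnit B.det ∧ R = Bᵀ * B := by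
  obtain ⟨B, hB⟩ := CStarAlgebra.nonneg_iff_eq_star_mul_self.mp hR.posSemidef.nonneg
  have hRB : R = Bᵀ * B := by simpa [Matrix.star_eq_conjTranspose] using hB
  refine ⟨B, ?_, hRB⟩
  have h := (Matrix.isUnit_iff_isUnit_det _).mp hR.isUnit
  rw [hRB, Matrix.det_mul] at h
  exact isUnit_of_mul_isUnit_right h

/-- The tail sum of the generalized eigenvalues is controlled by that of the covariance matrix. -/
lemma sum_genEigenvalue_le {d : ℕ} {H S : Matrix (Fin d) (Fin d) ℝ} (hS : S.PosDef)
    {lam : Fin d → ℝ} (h : IsGenEigenvalues H S⁻¹ lam) {C : ℝ} (hC : 0 ≤ C)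
    (hH : ∀ x : Fin d → ℝ, x ⬝ᵥ (H *ᵥ x) ≤ C * (x ⬝ᵥ x)) (r : ℕ) :
    ∑ i with r ≤ i.val, lam i ≤ C * ∑ i with r ≤ i.val, hS.isHermitian.eigenvalues₀ i := by
  obtain ⟨U, hU, hSU⟩ := exists_orthogonal_diagonalization hS.isHermitian
  have hle := genEigenvalue_le h hU hSU ((Matrix.isUnit_iff_isUnit_det _).mp hS.isUnit)
    (fun i j hij => hS.isHermitian.eigenvalues₀_antitone (by simpa using hij))
    (fun i => by
      have := hS.eigenvalues_pos ((Fintype.equivOfCardEq (Fintype.card_fin _))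
        (Fin.cast (Fintype.card_fin d).symm i))
      simpa [Matrix.IsHermitian.eigenvalues] using this) hC hH
  have hsum : ∑ i with r ≤ i.val, hS.isHermitian.eigenvalues₀ i = ∑ i : Fin d with r ≤ i.val,
      hS.isHermitian.eigenvalues₀ (Fin.cast (Fintype.card_fin d).symm i) := by
    rw [Finset.sum_filter, Finset.sum_filter,
      ← (finCongr (Fintype.card_fin d).symm).sum_comp]
    rfl
  rw [hsum, Finset.mul_sum]
  exact Finset.sum_le_sum fun i _ => hle i

end RidgeApprox

theorem proposition3p1 {d n : ℕ} (r : ℕ)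
    (m : EuclideanSpace ℝ (Fin d)) (S : Matrix (Fin d) (Fin d) ℝ) (hS : S.PosDef)
    (R : Matrix (Fin n) (Fin n) ℝ) (hR : R.PosDef)
    (μ : MeasureTheory.Measure (EuclideanSpace ℝ (Fin d)))
    (hμ : μ = ProbabilityTheory.multivariateGaussian m S)
    (f : EuclideanSpace ℝ (Fin d) → EuclideanSpace ℝ (Fin n))
    (hfH : RidgeApprox.MemH R μ f) (hf : ContDiff ℝ 1 f)
    (L : ℝ) (hL : 0 ≤ L)
    (hLip : ∀ x y, RidgeApprox.vNorm R (f x - f y) ≤ L * ‖x - y‖)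
    (P : Matrix (Fin d) (Fin d) ℝ)
    (hP : RidgeApprox.IsOptimalProjector r S (RidgeApprox.gradMatrix R μ f) P)
    (lam : Fin d → ℝ)
    (hlam : RidgeApprox.IsGenEigenvalues (RidgeApprox.gradMatrix R μ f) S⁻¹ lam) :
    RidgeApprox.MemH R μ
        (fun x => f x - MeasureTheory.condExp (RidgeApprox.sigmaAlg P) μ f x) ∧
      RidgeApprox.hNorm R μ
        (fun x => f x - MeasureTheory.condExp (RidgeApprox.sigmaAlg P) μ f x) ^ 2 ≤
          ∑ i with r ≤ i.val, lam i ∧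
      ∑ i with r ≤ i.val, lam i ≤
        L ^ 2 * ∑ i with r ≤ i.val, hS.isHermitian.eigenvalues₀ i := by

  obtain ⟨B, hBu, hB⟩ := RidgeApprox.exists_isUnit_transpose_mul_self hR
  have hG : LipschitzWith ⟨L, hL⟩ fun x => RidgeApprox.mulCLM B (f x) :=
    LipschitzWith.of_dist_le_mul fun x y => by
      rw [dist_eq_norm, dist_eq_norm, ← map_sub, ← RidgeApprox.vNorm_eq_norm hB]
      exact hLip x y
  -- Invertibility of `B` carries the Lipschitz property from `B f` back to `f`, with some constant;
  -- it is only used for integrability.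
  obtain ⟨K, hfl⟩ : ∃ K, LipschitzWith K f := by
    have h : f = RidgeApprox.mulCLM B⁻¹ ∘ fun x => RidgeApprox.mulCLM B (f x) := by
      funext x
      rw [Function.comp_apply, RidgeApprox.mulCLM_mulCLM, Matrix.nonsing_inv_mul _ hBu,
        RidgeApprox.mulCLM, map_one]
      rfl
    rw [h]
    exact ⟨_, (RidgeApprox.mulCLM B⁻¹).lipschitz.comp hG⟩
  subst hμ
  have hfi : MeasureTheory.Integrable f (ProbabilityTheory.multivariateGaussian m S) :=
    (RidgeApprox.memLp_lipschitzWith hfl ENNReal.one_ne_top).integrable le_rfl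
  obtain ⟨hint, hbound⟩ :=
    RidgeApprox.integral_vNorm_sq_sub_condExp_le hS hR hB hP.1.1 hf hG hfi
  have hr : r ≤ d := hP.1.2 ▸ P.rank_le_width
  obtain ⟨Q, hQ, hQb⟩ := RidgeApprox.exists_isProjector_poincareBound_eq hS hlam hr
  refine ⟨⟨hfi.1.sub MeasureTheory.integrable_condExp.1, hint⟩, ?_, ?_⟩
  · rw [RidgeApprox.hNorm, Real.sq_sqrt (MeasureTheory.integral_nonneg fun x => sq_nonneg _)]
    exact hbound.trans ((hP.2 Q hQ).trans_eq hQb)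
  · refine RidgeApprox.sum_genEigenvalue_le hS hlam (sq_nonneg L) (fun x => ?_) r
    -- The quadratic form of `H` is a mean of `‖D(B f) x‖²`, and `B f` is `L`-Lipschitz, whence `H ≤
    -- L² I`.
    have hx := RidgeApprox.dotProduct_gradMatrix_mulVec hB
      (μ := ProbabilityTheory.multivariateGaussian m S) hf hG (WithLp.toLp 2 x)
    have hn := RidgeApprox.norm_sq_eq_dotProduct (WithLp.toLp 2 x)
    rw [WithLp.ofLp_toLp] at hx hn
    rw [hx, ← hn, ← mul_pow]
    refine (MeasureTheory.integral_mono_of_nonneg (.of_forall fun y => sq_nonneg _)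
      (MeasureTheory.integrable_const ((L * ‖WithLp.toLp 2 x‖) ^ 2))
      (.of_forall fun y => ?_)).trans_eq (by simp)
    exact pow_le_pow_left₀ (norm_nonneg _) (RidgeApprox.norm_fderiv_apply_le hG y _) 2
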